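/- Let $X\subset\mathbb R^d$ be compact and nonempty, let $C(X)$ denote the continuous real-valued functions on $X$ with the supremum norm, and let $Y\subseteq C(X)$ satisfy $\|y\|_\infty\le\beta$ for all $y\in Y$. **Game.** In each round $t=1,\dots,T$, the learner chooses a probability distribution $p_t$ on $X$ depending measurably on the history $(x_s,y_s)_{s<t}$; then the adversary chooses a probability distribution $q_t$ concentrated on $Y$, depending measurably on the history and on $p_t$; then $x_t\sim p_t$ and $y_t\sim q_t$ are drawn conditionally independently given the history. The expected regret is $$R(p,q)=\mathbb E\Big[\sup_{x\in X}\sum_{t=1}^T y_t(x)-\sum_{t=1}^T y_t(x_t)\Big].$$ **Prior.** Let $\gamma_1,\dots,\gamma_T$ be independent random elements of $C(X)$, each a centered Gaussian process with covariance kernel $k$, where $k:X\times X\to\mathbb R$ is continuous and strictly positive definite, and where $\gamma_1$ has a global expected modulus of continuity: there is a continuous $\omega:[0,\infty]\to[0,\infty]$ with $\omega(0)=0$ and $\mathbb E\sup_{\|x-x'\|<h}|\gamma_1(x)-\gamma_1(x')|\le\omega(h)$ for all $h$. Assume that $k(x,x)=\sigma^2$ for all $x\in X$, and that there is a constant $C_{Y,k}>0$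 such that for all $x,x'\in X$ $$\sup_{y\in Y}\Big(y(x)-y(x')\frac{k(x,x')}{k(x',x')}\Big)\le C_{Y,k}\Big(1-\frac{k(x,x')}{k(x',x')}\Big).$$ **Thompson sampling.** Fix a (measurable) tie-breaking rule, that is, a map $\alpha:C(X)\to X$ with $\alpha(f)\in\arg\max_{x\in X} f(x)$ for every $f$. In round $t$ the learner draws one sample of $\sum_{\tau=1}^T\gamma_\tau$ from its conditional distribution given $\gamma_1=y_1,\dots,\gamma_{t-1}=y_{t-1}$ and plays the maximizer of this sample; since the prior is independent over time, this means $$x_t=\alpha\Big(\sum_{\tau=1}^{t-1}y_\tau+\sum_{\tau=t}^{T}\gamma_\tau\Big)$$ with a fresh draw of $(\gamma_t,\dots,\gamma_T)$ from the prior in every round. **Claim.** If $p$ is Thompson sampling then, for every adversary strategy $q$, the expectations below are finite and $$R(p,q)\le\sqrt T\left(1+\frac{\beta(\beta+C_{Y,k})}{\sigma^2}\right)\mathbb E\sup_{x\in X}\gamma_1(x).$$ -/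

import Mathlib

open MeasureTheory ProbabilityTheory
open scoped ENNReal

noncomputable section

namespace OnlineLearning

section General

variable {X : Type*} [TopologicalSpace X]

/-- `C(X, ℝ)` carries the Borel σ-algebra of its (compact-open) topology; for compact `X` this is
the topology of uniform convergence. -/
instance instMeasurableSpaceContinuousMap : MeasurableSpace C(X, ℝ) := borel _

instance instBorelSpaceContinuousMap : BorelSpace C(X, ℝ) := ⟨rfl⟩

/-! ### The online learning game

Rounds are numbered `0, 1, …, T - 1`. -/

section Game

variable [MeasurableSpace X]

/-- The history of the game before round `t`: the actions and reward functions played so far. -/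
abbrev History (X : Type*) [TopologicalSpace X] (t : ℕ) : Type _ := Fin t → X × C(X, ℝ)

/-- A strategy of the learner: given the history before round `t`, a distribution on actions. -/
abbrev LearnerStrategy (X : Type*) [TopologicalSpace X] [MeasurableSpace X] : Type _ :=
  ∀ t : ℕ, Kernel (History X t) X

/-- A strategy of the adversary: given the history before round `t` and the mixed action that the
learner has chosen in round `t`, a distribution on reward functions. -/
abbrev AdversaryStrategy (X : Type*) [TopologicalSpace X] [MeasurableSpace X] : Type _ :=
  ∀ t : ℕ, Kernel (History X t × Measure X) C(X, ℝ)

/-- In round `t`, given the history `h`, the adversary draws from `q t (h, p t h)`. -/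
def adversaryResponse (p : LearnerStrategy X) (q : AdversaryStrategy X) (t : ℕ) :
    Kernel (History X t) C(X, ℝ) :=
  (q t).comap (fun h => (h, p t h)) (measurable_id.prodMk (p t).measurable)

/-- Law of the history before round `t`. In each round the action and the reward function are drawn
conditionally independently given the history. -/
def playLaw (p : LearnerStrategy X) (q : AdversaryStrategy X) : ∀ t : ℕ, Measure (History X t)
  | 0 => Measure.dirac Fin.elim0
  | t + 1 => (playLaw p q t ⊗ₘ (p t ×ₖ adversaryResponse p q t)).map
      (fun z => (Fin.snoc z.1 z.2 : History X (t + 1)))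

/-- Realized regret of a complete play of `T` rounds. -/
def realizedRegret {T : ℕ} (h : History X T) : ℝ :=
  (⨆ x : X, ∑ t : Fin T, (h t).2 x) - ∑ t : Fin T, (h t).2 (h t).1

/-- Expected regret `R(p, q)` over `T` rounds. -/
def regret (T : ℕ) (p : LearnerStrategy X) (q : AdversaryStrategy X) : ℝ :=
  ∫ h, realizedRegret h ∂(playLaw p q T)

end Game

/-! ### Thompson sampling -/

section Posterior

variable {E : Type*} [MeasurableSpace E] {T : ℕ}

/-- The first `t` entries of a sequence of length `T`. -/
def past {t : ℕ} (ht : t ≤ T) (γ : Fin T → E) : Fin t → E := fun s => γ (Fin.castLE ht s)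

/-- The sequence which agrees with `y` before time `t` and with `γ` from time `t` on. -/
def splice {t : ℕ} (y : Fin t → E) (γ : Fin T → E) : Fin T → E :=
  fun τ => if h : (τ : ℕ) < t then y ⟨τ, h⟩ else γ τ

/-- `κ` is a regular conditional distribution of the whole sequence `γ ∼ Q` given its first `t`
entries. -/
def IsPosterior (Q : Measure (Fin T → E)) {t : ℕ} (ht : t ≤ T)
    (κ : Kernel (Fin t → E) (Fin T → E)) : Prop :=
  Q.map (past ht) ⊗ₘ κ = Q.map (fun γ => (past ht γ, γ))

/-- The conditional distribution of `γ ∼ Q` given `γ₀ = y₀, …, γ_{t-1} = y_{t-1}` when `Q` is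
independent over time: the first `t` entries are the observed ones, and the remaining entries
have the same law as under `Q`. -/
def independentPosterior (Q : Measure (Fin T → E)) (t : ℕ) :
    Kernel (Fin t → E) (Fin T → E) :=
  (Kernel.id ×ₖ Kernel.const _ Q).map (fun z => splice z.1 z.2)

lemma measurable_past {t : ℕ} (ht : t ≤ T) : Measurable (past ht : (Fin T → E) → Fin t → E) :=
  measurable_pi_lambda _ fun _ => measurable_pi_apply _

lemma measurable_splice {t : ℕ} :
    Measurable (fun z : (Fin t → E) × (Fin T → E) => splice z.1 z.2) := by
  refine measurable_pi_lambda _ fun τ => ?_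
  by_cases h : (τ : ℕ) < t
  · simpa [splice, h, Function.comp_def] using
      (measurable_pi_apply (⟨τ, h⟩ : Fin t)).comp (measurable_fst (β := Fin T → E))
  · simpa [splice, h, Function.comp_def] using
      (measurable_pi_apply τ).comp (measurable_snd (α := Fin t → E))

lemma map_splice_pi (ν : Fin T → Measure E) [∀ i, IsProbabilityMeasure (ν i)] {t : ℕ}
    (ht : t ≤ T) :
    ((Measure.pi ν).prod (Measure.pi ν)).map (fun z => splice (past ht z.1) z.2)
      = Measure.pi ν := by
  have hm : Measurable (fun z : (Fin T → E) × (Fin T → E) => splice (past ht z.1) z.2) :=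
    measurable_splice.comp (((measurable_past ht).comp measurable_fst).prodMk measurable_snd)
  refine (Measure.pi_eq fun s hs => ?_).symm
  rw [Measure.map_apply hm (MeasurableSet.univ_pi hs)]
  have hpre : (fun z : (Fin T → E) × (Fin T → E) => splice (past ht z.1) z.2) ⁻¹'
      (Set.univ.pi s) =
      (Set.univ.pi fun τ : Fin T => if (τ : ℕ) < t then s τ else Set.univ) ×ˢ
        (Set.univ.pi fun τ : Fin T => if (τ : ℕ) < t then Set.univ else s τ) := by
    ext z
    simp only [Set.mem_preimage, Set.mem_pi, Set.mem_univ, forall_const, Set.mem_prod]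
    rw [← forall_and]
    refine forall_congr' fun τ => ?_
    by_cases h : (τ : ℕ) < t
    · simp [splice, past, h]
    · simp [splice, h]
  rw [hpre, Measure.prod_prod, Measure.pi_pi, Measure.pi_pi, ← Finset.prod_mul_distrib]
  refine Finset.prod_congr rfl fun τ _ => ?_
  by_cases h : (τ : ℕ) < t <;> simp [h]

/-- For a prior that is independent over time, `independentPosterior` is indeed the posterior. -/
theorem isPosterior_independentPosterior (ν : Fin T → Measure E)
    [∀ i, IsProbabilityMeasure (ν i)] {t : ℕ} (ht : t ≤ T) :
    IsPosterior (Measure.pi ν) ht (independentPosterior (Measure.pi ν) t) := by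
  have hp := measurable_past (E := E) ht
  have : IsProbabilityMeasure ((Measure.pi ν).map (past ht)) :=
    Measure.isProbabilityMeasure_map hp.aemeasurable
  have hk : IsMarkovKernel (independentPosterior (Measure.pi ν) t) :=
    Kernel.IsMarkovKernel.map _ measurable_splice
  unfold IsPosterior
  have hm : Measurable (fun z : (Fin T → E) × (Fin T → E) => splice (past ht z.1) z.2) :=
    measurable_splice.comp ((hp.comp measurable_fst).prodMk measurable_snd)
  have hg : Measurable (fun γ : Fin T → E => (past ht γ, γ)) := hp.prodMk measurable_id
  refine Measure.ext_of_lintegral _ fun f hf => ?_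
  rw [Measure.lintegral_compProd hf, lintegral_map (Measurable.lintegral_kernel_prod_right' hf) hp,
    lintegral_map hf hg]
  conv_rhs => rw [← map_splice_pi ν ht]
  have hfg : Measurable fun γ : Fin T → E => f (past ht γ, γ) := hf.comp hg
  have hfgm : Measurable fun z : (Fin T → E) × (Fin T → E) =>
      f (past ht (splice (past ht z.1) z.2), splice (past ht z.1) z.2) := hfg.comp hm
  rw [lintegral_map hfg hm, lintegral_prod _ hfgm.aemeasurable]
  refine lintegral_congr fun γ => ?_
  have hf' : Measurable fun γ' : Fin T → E => f (past ht γ, γ') :=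
    hf.comp measurable_prodMk_left
  have hfs : Measurable fun z : (Fin t → E) × (Fin T → E) => f (past ht γ, splice z.1 z.2) :=
    hf'.comp measurable_splice
  rw [independentPosterior, Kernel.map_apply _ measurable_splice, Kernel.prod_apply,
    Kernel.id_apply, Kernel.const_apply, lintegral_map hf' measurable_splice,
    lintegral_prod _ hfs.aemeasurable, lintegral_dirac']
  · refine lintegral_congr fun γ' => ?_
    have : past ht (splice (past ht γ) γ') = past ht γ := by
      ext s
      simp [past, splice]
    simp [this]
  · exact hfs.lintegral_prod_right'

end Posterior

section Thompson

variable [MeasurableSpace X]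

/-- A tie-breaking rule: a choice of maximizer for every continuous function. -/
def IsTieBreakingRule (α : C(X, ℝ) → X) : Prop := ∀ (f : C(X, ℝ)) (x : X), f x ≤ f (α f)

/-- Thompson sampling with tie-breaking rule `α` and posterior kernels `post`: in round `t`, given
the reward functions `y₀, …, y_{t-1}` of the history, draw a sequence `γ` from the posterior given
these, and play the maximizer of `∑ τ, γ τ`. -/
def thompsonSampling {T : ℕ} (α : C(X, ℝ) → X)
    (post : ∀ t : ℕ, Kernel (Fin t → C(X, ℝ)) (Fin T → C(X, ℝ))) : LearnerStrategy X :=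
  fun t => ((post t).map (fun γ => α (∑ τ, γ τ))).comap (fun h s => (h s).2)
    (measurable_pi_lambda _ fun s => measurable_snd.comp (measurable_pi_apply s))

end Thompson

/-! ### Gaussian processes and kernels -/

/-- `μ` is the law on `C(X, ℝ)` of a centered Gaussian process with covariance kernel `k`. -/
structure IsGP (μ : Measure C(X, ℝ)) (k : X → X → ℝ) : Prop where
  gaussian : IsGaussianProcess (fun (x : X) (f : C(X, ℝ)) => f x) μ
  mean : ∀ x, ∫ f, f x ∂μ = 0
  cov : ∀ x x', cov[fun f : C(X, ℝ) => f x, fun f : C(X, ℝ) => f x'; μ] = k x x'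

/-- `k` is strictly positive definite: its Gram matrix on every finite set of (distinct) points is
positive definite. -/
def IsStrictlyPositiveDefinite (k : X → X → ℝ) : Prop :=
  ∀ s : Finset X, (Matrix.of fun i j : s => k i j).PosDef

/-- The random function with law `μ` has a global expected modulus of continuity. -/
def HasExpectedModulus {X : Type*} [PseudoEMetricSpace X] (μ : Measure C(X, ℝ)) : Prop :=
  ∃ ω : ℝ≥0∞ → ℝ≥0∞, Continuous ω ∧ ω 0 = 0 ∧
    ∀ h, ∫⁻ f, (⨆ (x : X) (x' : X) (_ : edist x x' < h), edist (f x) (f x')) ∂μ ≤ ω h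

/-- The inequality relating the reward functions `Y` and the kernel `k` with constant `C`. -/
def KernelCondition (Y : Set C(X, ℝ)) (k : X → X → ℝ) (C : ℝ) : Prop :=
  ∀ x x' : X, ∀ y ∈ Y, y x - y x' * (k x x' / k x' x') ≤ C * (1 - k x x' / k x' x')

end General

end OnlineLearning

end

/-!
Thompson sampling is follow-the-perturbed-leader: with `n` rounds to go and cumulative reward `S`,
the posterior sample has the law of `S + √n γ`, because a sum of `n` independent copies of a
centered Gaussian process has the law of one copy scaled by `√n` (`IsGP.map_sum_pi`,
`thompsonSampling_apply`). Its regret is controlled through the potential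
`Φ c f = E sup (f + c γ)`. It starts at `Φ √T 0 = √T E sup γ` and ends at `Φ 0 S = sup S`, so that
the excess of the regret over `√T E sup γ` is the expected sum over the rounds of
`Φ √(n-1) (S + y) - Φ √n S - E y (α (S + √n γ))`.

Since `Φ` increases with the scale (`potential_mono`), each of these terms is at most the error of
the first-order expansion of `Φ √n` at `S` in the direction `y`: the last expectation is a
subgradient, whatever the tie-breaking rule. This error is bounded by half a semiconcavity constant
(`le_of_concaveOn_sub_sq`), which takes the place of a bound on the second derivative and makes it
unnecessary to know that the maximizer is almost surely unique (`potential_add_le`).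

The heart of the proof is that semiconcavity constant (`concaveOn_integral_smoothMax`). Restrict to
finitely many points and replace the maximum by a log-sum-exp function. The off-diagonal entries
`-θ wᵢ wⱼ` of its Hessian are nonpositive and its rows sum to zero, so that, in expectation,
* the second derivative in the direction `y` is `θ E ∑ wᵢ wⱼ (yᵢ - yⱼ)² / 2`, and
* Gaussian integration by parts gives `E ∑ wᵢ γᵢ = √n θ E ∑ wᵢ wⱼ (σ² - kᵢⱼ)`, which is at most
  `E sup γ` (`integral_sum_gibbs_mul`).

The kernel condition gives `(yᵢ - yⱼ)² / 2 ≤ β (β + C) / σ² * (σ² - kᵢⱼ)`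
(`IsGP.sq_sub_le_of_kernelCondition`), and comparing the two bounds the second derivative
by `β (β + C) / (σ² √n) * E sup γ`, independently of the temperature and of the number of points.
The bound survives the limit along a dense sequence of points (`concaveOn_potential`), and summing
`1 / (2 √n)` over the rounds gives at most `√T`.
-/

noncomputable section

namespace OnlineLearning

/-! ### Gaussian integration by parts -/

lemma hasDerivAt_gaussianPDFReal_zero {v : NNReal} (hv : v ≠ 0) (u : ℝ) :
    HasDerivAt (gaussianPDFReal 0 v) (-(u / v) * gaussianPDFReal 0 v u) u := by
  have hv' : (v : ℝ) ≠ 0 := by exact_mod_cast hv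
  have h1 : HasDerivAt (fun x : ℝ => -(x - 0) ^ 2 / (2 * v)) (-(u / v)) u := by
    have := ((((hasDerivAt_id u).sub_const 0).pow 2).neg).div_const (2 * (v : ℝ))
    refine this.congr_deriv ?_
    simp
    field_simp
  have h2 := h1.exp.const_mul (√(2 * Real.pi * v))⁻¹
  rw [gaussianPDFReal_def]
  refine h2.congr_deriv ?_
  ring

/-- One-dimensional Gaussian integration by parts. -/
lemma integral_mul_gaussianReal_zero {v : NNReal} (hv : v ≠ 0) {h h' : ℝ → ℝ}
    (hd : ∀ u, HasDerivAt h (h' u) u) (hm : Measurable h') {A B : ℝ} (hA : ∀ u, |h u| ≤ A)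
    (hB : ∀ u, |h' u| ≤ B) :
    ∫ u, u * h u ∂(gaussianReal 0 v) = v * ∫ u, h' u ∂(gaussianReal 0 v) := by
  have hv' : (v : ℝ) ≠ 0 := by exact_mod_cast hv
  have hmh : Measurable h := (continuous_iff_continuousAt.2 fun u => (hd u).continuousAt).measurable
  have hρ := integrable_gaussianPDFReal 0 v
  have hid : Integrable (fun u : ℝ => gaussianPDFReal 0 v u * u) := by
    have h1 : Integrable (fun u : ℝ => u) (gaussianReal 0 v) :=
      (memLp_id_gaussianReal (μ := 0) (v := v) 1).integrable (by simp)
    rw [gaussianReal_of_var_ne_zero _ hv, integrable_withDensity_iff_integrable_smul'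
      (measurable_gaussianPDF _ _) (ae_of_all _ fun _ => gaussianPDF_lt_top)] at h1
    simpa using h1
  have i1 : Integrable (fun u => gaussianPDFReal 0 v u * h' u) :=
    hρ.mul_bdd hm.aestronglyMeasurable (ae_of_all _ hB)
  have i2 : Integrable (fun u => gaussianPDFReal 0 v u * h u) :=
    hρ.mul_bdd hmh.aestronglyMeasurable (ae_of_all _ hA)
  have i3 : Integrable (fun u => gaussianPDFReal 0 v u * u * h u) :=
    hid.mul_bdd hmh.aestronglyMeasurable (ae_of_all _ hA)
  have key := integral_eq_zero_of_hasDerivAt_of_integrable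
    (f := fun u => gaussianPDFReal 0 v u * h u)
    (f' := fun u => gaussianPDFReal 0 v u * h' u - (v : ℝ)⁻¹ * (gaussianPDFReal 0 v u * u * h u))
    (fun u => by
      refine ((hasDerivAt_gaussianPDFReal_zero hv u).mul (hd u)).congr_deriv ?_
      field_simp
      ring)
    (i1.sub (i3.const_mul _)) i2
  rw [integral_sub i1 (i3.const_mul _), integral_const_mul, sub_eq_zero] at key
  rw [integral_gaussianReal_eq_integral_smul hv, integral_gaussianReal_eq_integral_smul hv]
  simp only [smul_eq_mul]
  rw [key, mul_inv_cancel_left₀ hv']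
  simp only [mul_assoc]

/-- Gaussian integration by parts for a centered Gaussian vector `G` with covariance `K`:
`E[G i * F G]` is the expected derivative of `F` in the direction `K i`. The residual
`G - (G i / K i i) • K i` is uncorrelated with, hence independent of, `G i`, so that the
one-dimensional formula applies conditionally on it. -/
lemma integral_eval_mul_of_hasGaussianLaw {Ω ι : Type*} [Fintype ι] [MeasurableSpace Ω]
    {P : Measure Ω} {G : Ω → ι → ℝ} (hG : HasGaussianLaw G P) (h0 : ∀ i, ∫ ω, G ω i ∂P = 0)
    {K : ι → ι → ℝ} (hK : ∀ i j, cov[fun ω => G ω i, fun ω => G ω j; P] = K i j) (i : ι)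
    (hi : K i i ≠ 0) {F F' : (ι → ℝ) → ℝ} (hF : Continuous F)
    (hF' : ∀ z, HasDerivAt (fun u : ℝ => F (z + u • K i)) (F' z) 0) (hm : Measurable F')
    {A B : ℝ} (hA : ∀ z, |F z| ≤ A) (hB : ∀ z, |F' z| ≤ B) :
    ∫ ω, G ω i * F (G ω) ∂P = ∫ ω, F' (G ω) ∂P := by
  have := hG.isProbabilityMeasure
  have hGm := hG.aemeasurable
  have hGi : HasGaussianLaw (fun ω => G ω i) P := hG.eval i
  have hL2 : ∀ j, MemLp (fun ω => G ω j) 2 P := fun j => (hG.eval j).memLp_two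
  have hvar : Var[fun ω => G ω i; P] = K i i := by
    rw [← covariance_self hGi.aemeasurable, hK]
  obtain ⟨v, hv⟩ : ∃ v : NNReal, (v : ℝ) = K i i :=
    ⟨⟨K i i, hvar ▸ variance_nonneg _ _⟩, rfl⟩
  have hv0 : v ≠ 0 := by
    rintro rfl
    exact hi (by simpa using hv.symm)
  have hlaw : P.map (fun ω => G ω i) = gaussianReal 0 v := by
    rw [hGi.map_eq_gaussianReal, h0, hvar, ← hv, Real.toNNReal_coe]
  -- the part of `G` that is uncorrelated with `G i`
  let W : Ω → ι → ℝ := fun ω j => G ω j - K i j / K i i * G ω i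
  have hWm : AEMeasurable W P := by fun_prop
  have hind : IndepFun (fun ω => G ω i) W P := by
    have h1 : HasGaussianLaw (fun ω => (fun _ : Unit => G ω i, fun j => W ω j)) P := by
      let L : (ι → ℝ) →L[ℝ] (Unit → ℝ) × (ι → ℝ) :=
        (ContinuousLinearMap.pi fun _ => ContinuousLinearMap.proj i).prod
          (ContinuousLinearMap.pi fun j => ContinuousLinearMap.proj j -
            (K i j / K i i) • ContinuousLinearMap.proj i)
      exact hG.map_fun L
    have h2 := HasGaussianLaw.indepFun_of_covariance_eval
      (X := fun (_ : Unit) ω => G ω i) (Y := fun j ω => W ω j) h1 (fun _ j => by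
        have e : (fun ω => W ω j) = (fun ω => G ω j) - fun ω => K i j / K i i * G ω i := rfl
        rw [e, covariance_sub_right (hL2 i) (hL2 j) ((hL2 i).const_mul _),
          covariance_const_mul_right, hK, hK]
        field_simp
        ring)
    exact h2.comp (φ := fun f : Unit → ℝ => f ()) (measurable_pi_apply ()) measurable_id
  have hprod := (indepFun_iff_map_prod_eq_prod_map_map hGi.aemeasurable hWm).1 hind
  have hGW : ∀ ω, G ω = W ω + (G ω i / K i i) • K i := by
    intro ω
    ext j
    simp only [W, Pi.add_apply, Pi.smul_apply, smul_eq_mul]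
    ring
  have hFm : Measurable F := hF.measurable
  have hm1 : Measurable fun z : ℝ × (ι → ℝ) => z.1 * F (z.2 + (z.1 / K i i) • K i) := by fun_prop
  have hm2 : Measurable fun z : ℝ × (ι → ℝ) => F' (z.2 + (z.1 / K i i) • K i) := by fun_prop
  have hpair : AEMeasurable (fun ω => (G ω i, W ω)) P := hGi.aemeasurable.prodMk hWm
  have := Measure.isProbabilityMeasure_map (μ := P) hWm
  have e1 : ∫ ω, G ω i * F (G ω) ∂P
      = ∫ z, z.1 * F (z.2 + (z.1 / K i i) • K i) ∂((gaussianReal 0 v).prod (P.map W)) := by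
    rw [← hlaw, ← hprod, integral_map hpair hm1.aestronglyMeasurable]
    exact integral_congr_ae (ae_of_all _ fun ω => by simp only; rw [← hGW])
  have e2 : ∫ ω, F' (G ω) ∂P
      = ∫ z, F' (z.2 + (z.1 / K i i) • K i) ∂((gaussianReal 0 v).prod (P.map W)) := by
    rw [← hlaw, ← hprod, integral_map hpair hm2.aestronglyMeasurable]
    exact integral_congr_ae (ae_of_all _ fun ω => by simp only; rw [← hGW])
  have hidint : Integrable (fun u : ℝ => u) (gaussianReal 0 v) :=
    (memLp_id_gaussianReal (μ := 0) (v := v) 1).integrable (by simp)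
  rw [e1, e2, integral_prod_symm _ ?_, integral_prod_symm _ ?_]
  · refine integral_congr_ae (ae_of_all _ fun w => ?_)
    simp only
    rw [integral_mul_gaussianReal_zero hv0 (h := fun u => F (w + (u / K i i) • K i))
      (h' := fun u => (K i i)⁻¹ * F' (w + (u / K i i) • K i)) (A := A) (B := |(K i i)⁻¹| * B)]
    · rw [integral_const_mul, hv, mul_inv_cancel_left₀ hi]
    · intro u
      have h1 : HasDerivAt (fun s : ℝ => (s - u) / K i i) (K i i)⁻¹ u := by
        simpa using ((hasDerivAt_id u).sub_const u).div_const (K i i)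
      have h2 := HasDerivAt.comp u (h₂ := fun s : ℝ => F ((w + (u / K i i) • K i) + s • K i))
        (h := fun s : ℝ => (s - u) / K i i) (by simpa using hF' (w + (u / K i i) • K i)) h1
      have e : (fun s : ℝ => F ((w + (u / K i i) • K i) + s • K i)) ∘ (fun s => (s - u) / K i i)
          = fun s => F (w + (s / K i i) • K i) := by
        ext s
        simp only [Function.comp, add_assoc, ← add_smul]
        congr 3
        ring
      rw [e] at h2
      exact h2.congr_deriv (mul_comm _ _)
    · fun_prop
    · exact fun u => hA _
    · intro u
      rw [abs_mul]
      exact mul_le_mul_of_nonneg_left (hB _) (abs_nonneg _)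
  · exact Integrable.of_bound hm2.aestronglyMeasurable B (ae_of_all _ fun z => hB _)
  · refine (hidint.comp_fst _).mul_bdd (c := A) ?_ (ae_of_all _ fun z => hA _)
    exact Measurable.aestronglyMeasurable (by fun_prop)

/-! ### The smoothed maximum -/

section SmoothMax

variable {ι : Type*} [Fintype ι]

/-- The Gibbs weights `exp (θ z i) / ∑ j, exp (θ z j)` at inverse temperature `θ`. -/
def gibbs (θ : ℝ) (z : ι → ℝ) (i : ι) : ℝ := Real.exp (θ * z i) / ∑ j, Real.exp (θ * z j)

/-- The smoothed maximum `θ⁻¹ log ∑ j, exp (θ z j)` at inverse temperature `θ`. -/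
def smoothMax (θ : ℝ) (z : ι → ℝ) : ℝ := θ⁻¹ * Real.log (∑ j, Real.exp (θ * z j))

/-- The variance of `r` under weights `w` of total mass one, as a sum over pairs. -/
lemma sum_mul_sq_sub_sq_sum_mul {w r : ι → ℝ} (hw : ∑ i, w i = 1) :
    ∑ i, w i * (r i - ∑ j, w j * r j) * r i = ∑ i, ∑ j, w i * w j * ((r i - r j) ^ 2 / 2) := by
  have e1 : ∀ i j, w i * w j * ((r i - r j) ^ 2 / 2) =
      (w i * r i ^ 2) * w j / 2 + w i * (w j * r j ^ 2) / 2 - (w i * r i) * (w j * r j) := by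
    intro i j; ring
  simp only [e1, Finset.sum_sub_distrib, Finset.sum_add_distrib, ← Finset.sum_div,
    ← Finset.mul_sum, ← Finset.sum_mul, hw]
  have e2 : ∀ i, w i * (r i - ∑ j, w j * r j) * r i =
      w i * r i ^ 2 - (w i * r i) * ∑ j, w j * r j := by
    intro i; ring
  simp only [e2, Finset.sum_sub_distrib, ← Finset.sum_mul]
  ring

lemma hasDerivAt_sum_exp (θ : ℝ) (z r : ι → ℝ) (u : ℝ) :
    HasDerivAt (fun u : ℝ => ∑ j, Real.exp (θ * (z + u • r) j))
      (∑ j, Real.exp (θ * (z + u • r) j) * (θ * r j)) u := by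
  refine HasDerivAt.fun_sum fun j _ => ?_
  refine HasDerivAt.exp ?_
  simpa using (((hasDerivAt_id u).mul_const (r j)).const_add (z j)).const_mul θ

variable [Nonempty ι] {θ : ℝ}

lemma sum_exp_pos (θ : ℝ) (z : ι → ℝ) : 0 < ∑ j, Real.exp (θ * z j) :=
  Finset.sum_pos (fun _ _ => Real.exp_pos _) Finset.univ_nonempty

lemma gibbs_nonneg (θ : ℝ) (z : ι → ℝ) (i : ι) : 0 ≤ gibbs θ z i :=
  div_nonneg (Real.exp_pos _).le (sum_exp_pos θ z).le

lemma sum_gibbs (θ : ℝ) (z : ι → ℝ) : ∑ i, gibbs θ z i = 1 := by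
  simp only [gibbs, ← Finset.sum_div]
  exact div_self (sum_exp_pos θ z).ne'

lemma gibbs_le_one (θ : ℝ) (z : ι → ℝ) (i : ι) : gibbs θ z i ≤ 1 := by
  rw [← sum_gibbs θ z]
  exact Finset.single_le_sum (fun j _ => gibbs_nonneg θ z j) (Finset.mem_univ i)

lemma abs_gibbs_le_one (θ : ℝ) (z : ι → ℝ) (i : ι) : |gibbs θ z i| ≤ 1 := by
  rw [abs_of_nonneg (gibbs_nonneg θ z i)]
  exact gibbs_le_one θ z i

lemma continuous_gibbs (θ : ℝ) (i : ι) : Continuous fun z : ι → ℝ => gibbs θ z i := by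
  unfold gibbs
  exact Continuous.div (by fun_prop) (by fun_prop) fun z => (sum_exp_pos θ z).ne'

lemma continuous_smoothMax (θ : ℝ) : Continuous fun z : ι → ℝ => smoothMax θ z := by
  unfold smoothMax
  exact continuous_const.mul (Continuous.log (by fun_prop) fun z => (sum_exp_pos θ z).ne')

lemma sum_gibbs_mul_le {r : ι → ℝ} {b : ℝ} (hr : ∀ i, r i ≤ b) (z : ι → ℝ) :
    ∑ i, gibbs θ z i * r i ≤ b := by
  calc ∑ i, gibbs θ z i * r i ≤ ∑ i, gibbs θ z i * b :=
        Finset.sum_le_sum fun i _ => mul_le_mul_of_nonneg_left (hr i) (gibbs_nonneg θ z i)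
    _ = b := by rw [← Finset.sum_mul, sum_gibbs, one_mul]

lemma abs_sum_gibbs_mul_le {r : ι → ℝ} {b : ℝ} (hr : ∀ i, |r i| ≤ b) (z : ι → ℝ) :
    |∑ i, gibbs θ z i * r i| ≤ b := by
  refine abs_le.2 ⟨?_, sum_gibbs_mul_le (fun i => (abs_le.1 (hr i)).2) z⟩
  have := sum_gibbs_mul_le (θ := θ) (r := fun i => -r i) (fun i => neg_le.1 (abs_le.1 (hr i)).1) z
  simp only [mul_neg, Finset.sum_neg_distrib] at this
  linarith

lemma le_smoothMax (hθ : 0 < θ) (z : ι → ℝ) (i : ι) : z i ≤ smoothMax θ z := by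
  rw [smoothMax, ← div_eq_inv_mul, le_div_iff₀ hθ, mul_comm,
    Real.le_log_iff_exp_le (sum_exp_pos θ z)]
  exact Finset.single_le_sum (f := fun j => Real.exp (θ * z j)) (fun j _ => (Real.exp_pos _).le)
    (Finset.mem_univ i)

lemma smoothMax_le (hθ : 0 < θ) {z : ι → ℝ} {b : ℝ} (hz : ∀ i, z i ≤ b) :
    smoothMax θ z ≤ b + Real.log (Fintype.card ι) / θ := by
  have hc : (0 : ℝ) < Fintype.card ι := by exact_mod_cast Fintype.card_pos
  have h1 : ∑ j, Real.exp (θ * z j) ≤ Fintype.card ι * Real.exp (θ * b) := by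
    calc ∑ j, Real.exp (θ * z j) ≤ ∑ _j : ι, Real.exp (θ * b) :=
          Finset.sum_le_sum fun j _ => Real.exp_le_exp.2 (mul_le_mul_of_nonneg_left (hz j) hθ.le)
      _ = _ := by simp
  have h2 := Real.log_le_log (sum_exp_pos θ z) h1
  rw [Real.log_mul hc.ne' (Real.exp_pos _).ne', Real.log_exp] at h2
  rw [smoothMax, ← div_eq_inv_mul, div_le_iff₀ hθ, add_mul, div_mul_cancel₀ _ hθ.ne']
  linarith

lemma hasDerivAt_smoothMax (hθ : θ ≠ 0) (z r : ι → ℝ) (u : ℝ) :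
    HasDerivAt (fun u : ℝ => smoothMax θ (z + u • r)) (∑ i, gibbs θ (z + u • r) i * r i) u := by
  refine (((hasDerivAt_sum_exp θ z r u).log (sum_exp_pos θ _).ne').const_mul θ⁻¹).congr_deriv ?_
  rw [Finset.sum_div, Finset.mul_sum]
  refine Finset.sum_congr rfl fun i _ => ?_
  rw [gibbs]
  field_simp

lemma hasDerivAt_gibbs (θ : ℝ) (z r : ι → ℝ) (i : ι) (u : ℝ) :
    HasDerivAt (fun u : ℝ => gibbs θ (z + u • r) i)
      (θ * (gibbs θ (z + u • r) i * (r i - ∑ j, gibbs θ (z + u • r) j * r j))) u := by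
  have h1 : HasDerivAt (fun u : ℝ => Real.exp (θ * (z + u • r) i))
      (Real.exp (θ * (z + u • r) i) * (θ * r i)) u := by
    refine HasDerivAt.exp ?_
    simpa using (((hasDerivAt_id u).mul_const (r i)).const_add (z i)).const_mul θ
  have hs := (sum_exp_pos θ (z + u • r)).ne'
  refine (h1.div (hasDerivAt_sum_exp θ z r u) hs).congr_deriv ?_
  have e1 : ∑ j, gibbs θ (z + u • r) j * r j =
      (∑ j, Real.exp (θ * (z + u • r) j) * r j) / ∑ j, Real.exp (θ * (z + u • r) j) := by
    rw [Finset.sum_div]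
    exact Finset.sum_congr rfl fun j _ => by rw [gibbs]; ring
  have e2 : ∑ j, Real.exp (θ * (z + u • r) j) * (θ * r j) =
      θ * ∑ j, Real.exp (θ * (z + u • r) j) * r j := by
    rw [Finset.mul_sum]
    exact Finset.sum_congr rfl fun j _ => by ring
  rw [e1, e2, gibbs]
  field_simp

end SmoothMax

/-! ### Semiconcavity of the smoothed potential in finite dimension -/

/-- Differentiation under the integral sign for a uniformly bounded derivative. -/
lemma hasDerivAt_integral_of_bounded {Ω : Type*} [MeasurableSpace Ω] {P : Measure Ω}
    [IsFiniteMeasure P] {F F' : ℝ → Ω → ℝ} (hF : ∀ u, Integrable (F u) P)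
    (hF' : ∀ u, AEStronglyMeasurable (F' u) P) {b : ℝ} (hb : ∀ u ω, |F' u ω| ≤ b)
    (hd : ∀ u ω, HasDerivAt (fun u => F u ω) (F' u ω) u) (u : ℝ) :
    HasDerivAt (fun u => ∫ ω, F u ω ∂P) (∫ ω, F' u ω ∂P) u :=
  (hasDerivAt_integral_of_dominated_loc_of_deriv_le (bound := fun _ => b) Filter.univ_mem
    (.of_forall fun u => (hF u).aestronglyMeasurable) (hF u) (hF' u)
    (ae_of_all _ fun ω u _ => hb u ω) (integrable_const b) (ae_of_all _ fun ω u _ => hd u ω)).2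

/-- A function whose derivative has a derivative at most `L` becomes concave after subtracting the
parabola `L / 2 * u ^ 2`. -/
lemma concaveOn_sub_sq_of_hasDerivAt {φ φ' φ'' : ℝ → ℝ} (h1 : ∀ u, HasDerivAt φ (φ' u) u)
    (h2 : ∀ u, HasDerivAt φ' (φ'' u) u) {L : ℝ} (hL : ∀ u, φ'' u ≤ L) :
    ConcaveOn ℝ Set.univ (fun u => φ u - L / 2 * u ^ 2) := by
  have d1 : ∀ u, HasDerivAt (fun u => φ u - L / 2 * u ^ 2) (φ' u - L * u) u := fun u =>
    ((h1 u).sub ((hasDerivAt_pow 2 u).const_mul (L / 2))).congr_deriv (by simp; ring)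
  have d2 : ∀ u, HasDerivAt (fun u => φ' u - L * u) (φ'' u - L) u := fun u =>
    ((h2 u).sub ((hasDerivAt_id u).const_mul L)).congr_deriv (by simp)
  have e1 : deriv (fun u => φ u - L / 2 * u ^ 2) = fun u => φ' u - L * u :=
    funext fun u => (d1 u).deriv
  refine concaveOn_univ_of_deriv2_nonpos (fun u => (d1 u).differentiableAt) ?_ fun u => ?_
  · rw [e1]
    exact fun u => (d2 u).differentiableAt
  · simp only [Function.iterate_succ, Function.iterate_zero, Function.comp, id]
    rw [e1, (d2 u).deriv]
    linarith [hL u]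

section Finite

variable {Ω ι : Type*} [Fintype ι] [Nonempty ι] [MeasurableSpace Ω] {P : Measure Ω}
  {G : Ω → ι → ℝ} {K : ι → ι → ℝ} {s : ℝ}

/-- Integration by parts for the Gibbs average of a Gaussian vector of constant variance `s`. The
right-hand side is the pairing of the covariance with the Hessian of the smoothed maximum, whose
rows sum to zero. -/
lemma integral_sum_gibbs_mul (hG : HasGaussianLaw G P) (h0 : ∀ i, ∫ ω, G ω i ∂P = 0)
    (hK : ∀ i j, cov[fun ω => G ω i, fun ω => G ω j; P] = K i j) (hs : ∀ i, K i i = s)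
    (hs0 : s ≠ 0) (θ c : ℝ) (a : ι → ℝ) :
    ∫ ω, ∑ i, gibbs θ (a + c • G ω) i * G ω i ∂P =
      c * θ * ∫ ω, ∑ i, ∑ j,
        gibbs θ (a + c • G ω) i * gibbs θ (a + c • G ω) j * (s - K i j) ∂P := by
  have := hG.isProbabilityMeasure
  have hGm := hG.aemeasurable
  have hgc : ∀ i, Continuous fun z : ι → ℝ => gibbs θ (a + c • z) i := fun i =>
    (continuous_gibbs θ i).comp (by fun_prop)
  let F' : ι → (ι → ℝ) → ℝ := fun i z =>
    θ * (gibbs θ (a + c • z) i * (c * K i i - ∑ j, gibbs θ (a + c • z) j * (c * K i j)))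
  have hF'c : ∀ i, Continuous (F' i) := fun i => by
    have := hgc i
    have : ∀ j, Continuous fun z : ι → ℝ => gibbs θ (a + c • z) j * (c * K i j) :=
      fun j => (hgc j).mul continuous_const
    have := continuous_finsetSum Finset.univ fun j _ => this j
    fun_prop
  have hbd : ∀ i z, |F' i z| ≤ |θ| * (|c * K i i| + ∑ j, |c * K i j|) := fun i z => by
    have h1 : |∑ j, gibbs θ (a + c • z) j * (c * K i j)| ≤ ∑ j, |c * K i j| :=
      abs_sum_gibbs_mul_le (fun j => Finset.single_le_sum (f := fun j => |c * K i j|)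
        (fun _ _ => abs_nonneg _) (Finset.mem_univ j)) _
    simp only [F', abs_mul θ]
    refine mul_le_mul_of_nonneg_left ?_ (abs_nonneg _)
    rw [abs_mul (gibbs _ _ _), ← one_mul (|c * K i i| + _)]
    exact mul_le_mul (abs_gibbs_le_one _ _ _) ((abs_sub _ _).trans (by gcongr))
      (abs_nonneg _) zero_le_one
  have hstein : ∀ i, ∫ ω, G ω i * gibbs θ (a + c • G ω) i ∂P = ∫ ω, F' i (G ω) ∂P := fun i =>
    integral_eval_mul_of_hasGaussianLaw hG h0 hK i (by rw [hs]; exact hs0) (hgc i)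
      (fun z => by
        have h := hasDerivAt_gibbs θ (a + c • z) (c • K i) i 0
        simp only [zero_smul, add_zero] at h
        refine HasDerivAt.congr_of_eventuallyEq h (.of_forall fun u => ?_)
        simp only [smul_add, add_assoc, smul_comm u c])
      (hF'c i).measurable (A := 1) (fun z => abs_gibbs_le_one _ _ _) (hbd i)
  have hi1 : ∀ i, Integrable (fun ω => gibbs θ (a + c • G ω) i * G ω i) P := fun i =>
    (hG.eval i).integrable.bdd_mul
      ((hgc i).measurable.comp_aemeasurable hGm).aestronglyMeasurable
      (ae_of_all _ fun ω => abs_gibbs_le_one _ _ _)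
  have hi2 : ∀ i, Integrable (fun ω => F' i (G ω)) P := fun i =>
    Integrable.of_bound ((hF'c i).measurable.comp_aemeasurable hGm).aestronglyMeasurable _
      (ae_of_all _ fun ω => hbd i _)
  rw [integral_finsetSum _ fun i _ => hi1 i]
  simp_rw [mul_comm (gibbs _ _ _) (G _ _), hstein]
  rw [← integral_finsetSum _ fun i _ => hi2 i, ← integral_const_mul]
  refine integral_congr_ae (ae_of_all _ fun ω => ?_)
  simp only [F']
  rw [Finset.mul_sum]
  refine Finset.sum_congr rfl fun i _ => ?_
  have e : ∑ j, gibbs θ (a + c • G ω) i * gibbs θ (a + c • G ω) j * (s - K i j) =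
      gibbs θ (a + c • G ω) i * (s * (∑ j, gibbs θ (a + c • G ω) j) -
        ∑ j, gibbs θ (a + c • G ω) j * K i j) := by
    rw [Finset.mul_sum, ← Finset.sum_sub_distrib, Finset.mul_sum]
    exact Finset.sum_congr rfl fun j _ => by ring
  rw [e, sum_gibbs, hs]
  simp_rw [mul_left_comm _ c]
  rw [← Finset.mul_sum]
  ring

/-- If the squared increments of `y` are controlled by the increments `s - K i j` of the
covariance, the Gaussian smoothing of the smoothed maximum is semiconcave in the direction `y`,
with a constant that depends neither on the temperature nor on the number of coordinates. -/
lemma concaveOn_integral_smoothMax (hG : HasGaussianLaw G P) (h0 : ∀ i, ∫ ω, G ω i ∂P = 0)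
    (hK : ∀ i j, cov[fun ω => G ω i, fun ω => G ω j; P] = K i j) (hs : ∀ i, K i i = s)
    (hs0 : s ≠ 0) {θ c B : ℝ} (hθ : 0 < θ) (hc : 0 < c) (hB : 0 ≤ B) {a y : ι → ℝ}
    (hy : ∀ i j, (y i - y j) ^ 2 / 2 ≤ B * (s - K i j)) {m : Ω → ℝ} (hm : Integrable m P)
    (hGm : ∀ ω i, G ω i ≤ m ω) :
    ConcaveOn ℝ Set.univ (fun u : ℝ => ∫ ω, smoothMax θ (a + c • G ω + u • y) ∂P
      - B / c * (∫ ω, m ω ∂P) / 2 * u ^ 2) := by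
  have := hG.isProbabilityMeasure
  have hGmeas := hG.aemeasurable
  have hmeas : ∀ {f : (ι → ℝ) → ℝ} (_ : Continuous f) (u : ℝ),
      AEStronglyMeasurable (fun ω => f (a + c • G ω + u • y)) P := fun hf u =>
    (hf.measurable.comp_aemeasurable (by fun_prop)).aestronglyMeasurable
  obtain ⟨b, hb⟩ : ∃ b, ∀ i, |y i| ≤ b :=
    ⟨∑ i, |y i|, fun i => Finset.single_le_sum (f := fun j => |y j|)
      (fun _ _ => abs_nonneg _) (Finset.mem_univ i)⟩
  have hb0 : 0 ≤ b := (abs_nonneg _).trans (hb (Classical.arbitrary ι))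
  have hc1 : Continuous fun z : ι → ℝ => ∑ i, gibbs θ z i * y i :=
    continuous_finsetSum _ fun i _ => (continuous_gibbs θ i).mul continuous_const
  have hint : ∀ u : ℝ, Integrable (fun ω => smoothMax θ (a + c • G ω + u • y)) P := fun u => by
    have hsum : Integrable (fun ω => ∑ i, |(a + c • G ω + u • y) i|) P :=
      integrable_finsetSum _ fun i _ => by
        have := (hG.eval i).integrable
        simp only [Pi.add_apply, Pi.smul_apply, smul_eq_mul]
        exact ((((integrable_const (a i)).add (this.const_mul c))).add (integrable_const _)).abs
    refine (hsum.add (integrable_const |Real.log (Fintype.card ι) / θ|)).mono'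
      (hmeas (continuous_smoothMax θ) u) (ae_of_all _ fun ω => ?_)
    have hz : ∀ i, |(a + c • G ω + u • y) i| ≤ ∑ i, |(a + c • G ω + u • y) i| := fun i =>
      Finset.single_le_sum (f := fun j => |(a + c • G ω + u • y) j|)
      (fun _ _ => abs_nonneg _) (Finset.mem_univ i)
    have h1 := smoothMax_le hθ fun i => (le_abs_self _).trans (hz i)
    have h2 := le_smoothMax hθ (a + c • G ω + u • y) (Classical.arbitrary ι)
    have h3 := neg_le_of_abs_le (hz (Classical.arbitrary ι))
    have h4 := abs_nonneg (Real.log (Fintype.card ι) / θ)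
    have h5 := le_abs_self (Real.log (Fintype.card ι) / θ)
    change |_| ≤ (∑ i, |(a + c • G ω + u • y) i|) + |Real.log (Fintype.card ι) / θ|
    exact abs_le.2 ⟨by linarith, by linarith⟩
  -- the second derivative is an expected variance under the Gibbs weights
  let φ'' : ℝ → Ω → ℝ := fun u ω => θ * ∑ i, gibbs θ (a + c • G ω + u • y) i *
    (y i - ∑ j, gibbs θ (a + c • G ω + u • y) j * y j) * y i
  have hφ''c : Continuous fun z : ι → ℝ =>
      θ * ∑ i, gibbs θ z i * (y i - ∑ j, gibbs θ z j * y j) * y i :=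
    continuous_const.mul (continuous_finsetSum _ fun i _ =>
      ((continuous_gibbs θ i).mul (continuous_const.sub hc1)).mul continuous_const)
  have hφ''b : ∀ u ω, |φ'' u ω| ≤ θ * ((b + b) * b) := fun u ω => by
    simp only [φ'']
    rw [abs_mul, abs_of_pos hθ]
    refine mul_le_mul_of_nonneg_left ?_ hθ.le
    simp only [mul_assoc]
    refine abs_sum_gibbs_mul_le (fun i => ?_) _
    rw [abs_mul]
    exact mul_le_mul ((abs_sub _ _).trans (add_le_add (hb i) (abs_sum_gibbs_mul_le hb _))) (hb i)
      (abs_nonneg _) (by positivity)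
  refine concaveOn_sub_sq_of_hasDerivAt
    (φ' := fun u => ∫ ω, ∑ i, gibbs θ (a + c • G ω + u • y) i * y i ∂P)
    (φ'' := fun u => ∫ ω, φ'' u ω ∂P) ?_ ?_ fun u => ?_
  · exact hasDerivAt_integral_of_bounded hint (hmeas hc1) (b := b)
      (fun u ω => abs_sum_gibbs_mul_le hb _) fun u ω => hasDerivAt_smoothMax hθ.ne' _ _ _
  · refine hasDerivAt_integral_of_bounded (fun u => Integrable.of_bound (hmeas hc1 u) b
      (ae_of_all _ fun ω => abs_sum_gibbs_mul_le hb _)) (hmeas hφ''c) hφ''b fun u ω => ?_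
    simp only [φ'', Finset.mul_sum, ← mul_assoc]
    refine HasDerivAt.fun_sum fun i _ => ?_
    refine ((hasDerivAt_gibbs θ (a + c • G ω) y i u).mul_const (y i)).congr_deriv ?_
    simp only [mul_assoc]
  · have hws : ∀ ω, ∑ i, gibbs θ (a + c • G ω + u • y) i = 1 := fun ω => sum_gibbs _ _
    have hdc : Continuous fun z : ι → ℝ => ∑ i, ∑ j, gibbs θ z i * gibbs θ z j * (s - K i j) :=
      continuous_finsetSum _ fun i _ => continuous_finsetSum _ fun j _ =>
        ((continuous_gibbs θ i).mul (continuous_gibbs θ j)).mul continuous_const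
    have hdi : Integrable (fun ω => ∑ i, ∑ j, gibbs θ (a + c • G ω + u • y) i *
        gibbs θ (a + c • G ω + u • y) j * (s - K i j)) P := by
      refine Integrable.of_bound (hmeas hdc u) (∑ i, ∑ j, |s - K i j|) (ae_of_all _ fun ω => ?_)
      refine (norm_sum_le _ _).trans (Finset.sum_le_sum fun i _ => (norm_sum_le _ _).trans
        (Finset.sum_le_sum fun j _ => ?_))
      rw [norm_mul, norm_mul]
      refine mul_le_of_le_one_left (norm_nonneg _) ?_
      exact mul_le_one₀ (abs_gibbs_le_one _ _ _) (norm_nonneg _) (abs_gibbs_le_one _ _ _)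
    have hle : ∀ ω, φ'' u ω ≤ θ * B * ∑ i, ∑ j, gibbs θ (a + c • G ω + u • y) i *
        gibbs θ (a + c • G ω + u • y) j * (s - K i j) := fun ω => by
      simp only [φ'']
      rw [sum_mul_sq_sub_sq_sum_mul (hws ω), mul_assoc]
      refine mul_le_mul_of_nonneg_left ?_ hθ.le
      rw [Finset.mul_sum]
      refine Finset.sum_le_sum fun i _ => ?_
      rw [Finset.mul_sum]
      refine Finset.sum_le_sum fun j _ => ?_
      rw [mul_left_comm]
      exact mul_le_mul_of_nonneg_left (hy i j)
        (mul_nonneg (gibbs_nonneg _ _ _) (gibbs_nonneg _ _ _))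
    have hibp := integral_sum_gibbs_mul hG h0 hK hs hs0 θ c (a + u • y)
    simp only [add_right_comm a (u • y)] at hibp
    have hGi : Integrable (fun ω => ∑ i, gibbs θ (a + c • G ω + u • y) i * G ω i) P :=
      integrable_finsetSum _ fun i _ => (hG.eval i).integrable.bdd_mul
        (hmeas (continuous_gibbs θ i) u) (ae_of_all _ fun ω => abs_gibbs_le_one _ _ _)
    have hsup : ∫ ω, ∑ i, gibbs θ (a + c • G ω + u • y) i * G ω i ∂P ≤ ∫ ω, m ω ∂P :=
      integral_mono hGi hm fun ω => sum_gibbs_mul_le (hGm ω) _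
    calc ∫ ω, φ'' u ω ∂P ≤ ∫ ω, θ * B * ∑ i, ∑ j, gibbs θ (a + c • G ω + u • y) i *
        gibbs θ (a + c • G ω + u • y) j * (s - K i j) ∂P :=
          integral_mono (Integrable.of_bound (hmeas hφ''c u) _ (ae_of_all _ (hφ''b u)))
            (hdi.const_mul _) hle
      _ = B / c * ∫ ω, ∑ i, gibbs θ (a + c • G ω + u • y) i * G ω i ∂P := by
          rw [integral_const_mul, hibp]
          field_simp
      _ ≤ B / c * ∫ ω, m ω ∂P := mul_le_mul_of_nonneg_left hsup (by positivity)

end Finite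

/-! ### The supremum functional -/

section SupVal

variable {X : Type*} [MetricSpace X]

/-- The supremum of a continuous function. -/
def supVal (f : C(X, ℝ)) : ℝ := ⨆ x, f x

lemma supVal_smul {c : ℝ} (hc : 0 ≤ c) (f : C(X, ℝ)) : supVal (c • f) = c * supVal f := by
  simp [supVal, Real.mul_iSup_of_nonneg hc]

lemma supVal_zero [Nonempty X] : supVal (0 : C(X, ℝ)) = 0 := by simp [supVal]

lemma supVal_le [Nonempty X] {f : C(X, ℝ)} {b : ℝ} (h : ∀ x, f x ≤ b) : supVal f ≤ b := ciSup_le h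

variable [CompactSpace X]

lemma bddAbove_range_continuousMap (f : C(X, ℝ)) : BddAbove (Set.range f) :=
  (isCompact_range f.continuous).bddAbove

lemma le_supVal (f : C(X, ℝ)) (x : X) : f x ≤ supVal f :=
  le_ciSup (bddAbove_range_continuousMap f) x

variable [Nonempty X]

lemma supVal_eq_of_isTieBreakingRule {α : C(X, ℝ) → X} (hα : IsTieBreakingRule α) (f : C(X, ℝ)) :
    supVal f = f (α f) :=
  le_antisymm (supVal_le fun x => hα f x) (le_supVal f _)

lemma supVal_le_add_norm_sub (f g : C(X, ℝ)) : supVal f ≤ supVal g + ‖f - g‖ :=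
  supVal_le fun x => by
    have h1 := le_supVal g x
    have h2 := (le_abs_self _).trans ((f - g).norm_coe_le_norm x)
    simp only [ContinuousMap.sub_apply] at h2
    linarith

lemma abs_supVal_sub_le (f g : C(X, ℝ)) : |supVal f - supVal g| ≤ ‖f - g‖ :=
  abs_sub_le_iff.2 ⟨by linarith [supVal_le_add_norm_sub f g],
    by linarith [supVal_le_add_norm_sub g f, norm_sub_rev f g]⟩

lemma abs_supVal_le (f : C(X, ℝ)) : |supVal f| ≤ ‖f‖ := by
  simpa [supVal_zero] using abs_supVal_sub_le f 0

lemma continuous_supVal : Continuous (supVal : C(X, ℝ) → ℝ) :=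
  (LipschitzWith.of_dist_le_mul (K := 1) fun f g => by
    simpa [Real.dist_eq, dist_eq_norm] using abs_supVal_sub_le f g).continuous

/-- The smoothed maxima over longer and longer initial segments of a dense sequence, at suitably
increasing inverse temperatures, converge to the supremum. -/
lemma tendsto_smoothMax_denseSeq (f : C(X, ℝ)) :
    Filter.Tendsto (fun m : ℕ => smoothMax (((m : ℝ) + 1) ^ 2)
      fun i : Fin (m + 1) => f (TopologicalSpace.denseSeq X i)) Filter.atTop (nhds (supVal f)) := by
  refine tendsto_order.2 ⟨fun a ha => ?_, fun a ha => ?_⟩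
  · obtain ⟨x, hx⟩ := exists_lt_of_lt_ciSup ha
    obtain ⟨n, hn⟩ := (TopologicalSpace.denseRange_denseSeq X).exists_mem_open
      (isOpen_lt continuous_const f.continuous) ⟨x, hx⟩
    filter_upwards [Filter.eventually_ge_atTop n] with m hm
    exact lt_of_lt_of_le hn (le_smoothMax (by positivity)
      (fun i : Fin (m + 1) => f (TopologicalSpace.denseSeq X i)) ⟨n, by omega⟩)
  · have h : Filter.Tendsto (fun m : ℕ => supVal f + 1 / ((m : ℝ) + 1)) Filter.atTop
        (nhds (supVal f + 0)) := tendsto_const_nhds.add tendsto_one_div_add_atTop_nhds_zero_nat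
    rw [add_zero] at h
    filter_upwards [h.eventually_lt_const ha] with m hm
    refine lt_of_le_of_lt ?_ hm
    refine (smoothMax_le (by positivity) fun i => le_supVal f _).trans ?_
    have h1 : Real.log ((m : ℝ) + 1) ≤ (m : ℝ) + 1 :=
      (Real.log_le_sub_one_of_pos (by positivity)).trans (by linarith)
    simp only [Fintype.card_fin, Nat.cast_add, Nat.cast_one]
    refine add_le_add le_rfl ?_
    rw [div_le_div_iff₀ (by positivity) (by positivity)]
    nlinarith [show (0 : ℝ) ≤ m from m.cast_nonneg]

lemma abs_smoothMax_denseSeq_le (f : C(X, ℝ)) (m : ℕ) :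
    |smoothMax (((m : ℝ) + 1) ^ 2) fun i : Fin (m + 1) => f (TopologicalSpace.denseSeq X i)|
      ≤ ‖f‖ + 1 := by
  have hn : ∀ x, |f x| ≤ ‖f‖ := f.norm_coe_le_norm
  have h1 : Real.log ((m : ℝ) + 1) ≤ (m : ℝ) + 1 :=
    (Real.log_le_sub_one_of_pos (by positivity)).trans (by linarith)
  have h2 : Real.log ((m : ℝ) + 1) / ((m : ℝ) + 1) ^ 2 ≤ 1 := by
    rw [div_le_one (by positivity)]
    nlinarith [show (0 : ℝ) ≤ m from m.cast_nonneg]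
  have h3 := smoothMax_le (θ := ((m : ℝ) + 1) ^ 2) (by positivity)
    fun i : Fin (m + 1) => (abs_le.1 (hn (TopologicalSpace.denseSeq X i))).2
  have h4 := le_smoothMax (θ := ((m : ℝ) + 1) ^ 2) (by positivity)
    (fun i : Fin (m + 1) => f (TopologicalSpace.denseSeq X i)) 0
  have h5 := (abs_le.1 (hn (TopologicalSpace.denseSeq X ((0 : Fin (m + 1)) : ℕ)))).1
  simp only [Fintype.card_fin, Nat.cast_add, Nat.cast_one] at h3
  exact abs_le.2 ⟨by linarith, by linarith⟩

end SupVal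

/-! ### Integrability of the prior -/

section Prior

variable {X : Type*} [MetricSpace X] {μ : Measure C(X, ℝ)} {k : X → X → ℝ}

lemma IsGP.integrable_eval (hμ : IsGP μ k) (x : X) : Integrable (fun f : C(X, ℝ) => f x) μ :=
  (hμ.gaussian.hasGaussianLaw_eval x).integrable

/-- A finite `h`-net bounds the norm by finitely many evaluations and the oscillation at
scale `h`. -/
lemma IsGP.integrable_norm [CompactSpace X] (hμ : IsGP μ k) (hmod : HasExpectedModulus μ) :
    Integrable (fun f : C(X, ℝ) => ‖f‖) μ := by
  obtain ⟨ω, hω, hω0, hle⟩ := hmod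
  obtain ⟨h, hh, hωh⟩ : ∃ h : ℝ≥0∞, 0 < h ∧ ω h < ⊤ := by
    have h1 : ∀ᶠ h in nhdsWithin (0 : ℝ≥0∞) (Set.Ioi 0), ω h < ⊤ :=
      (hω.tendsto 0).mono_left nhdsWithin_le_nhds |>.eventually_lt_const (by simp [hω0])
    obtain ⟨h, h2, h3⟩ := (h1.and self_mem_nhdsWithin).exists
    exact ⟨h, h3, h2⟩
  obtain ⟨t, -, ht, hcov⟩ := EMetric.totallyBounded_iff'.1
    (isCompact_univ (X := X)).totallyBounded h hh
  lift t to Finset X using ht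
  have hbound : ∀ f : C(X, ℝ), ‖f‖ₑ ≤ ∑ x ∈ t, ‖f x‖ₑ +
      ⨆ (x : X) (x' : X) (_ : edist x x' < h), edist (f x) (f x') := by
    intro f
    set R := ∑ x ∈ t, ‖f x‖ₑ + ⨆ (x : X) (x' : X) (_ : edist x x' < h), edist (f x) (f x')
    by_cases hRt : R = ⊤
    · simp [hRt]
    have hx : ∀ x, ‖f x‖ₑ ≤ R := by
      intro x
      obtain ⟨x', hx', hd⟩ := Set.mem_iUnion₂.1 (hcov (Set.mem_univ x))
      have h1 : ‖f x‖ₑ ≤ ‖f x'‖ₑ + edist (f x) (f x') := by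
        rw [← edist_zero_right, ← edist_zero_right, add_comm]
        exact edist_triangle _ _ _
      refine h1.trans (add_le_add ?_ ?_)
      · exact Finset.single_le_sum (f := fun x => ‖f x‖ₑ) (fun _ _ => zero_le) hx'
      · exact le_iSup_of_le x (le_iSup_of_le x' (le_iSup_of_le hd le_rfl))
    rw [← ofReal_norm]
    refine ENNReal.ofReal_le_of_le_toReal ((ContinuousMap.norm_le f ENNReal.toReal_nonneg).2 ?_)
    intro x
    rw [← toReal_enorm]
    exact ENNReal.toReal_mono hRt (hx x)
  refine ⟨continuous_norm.aestronglyMeasurable, ?_⟩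
  rw [hasFiniteIntegral_def]
  simp only [enorm_norm]
  refine lt_of_le_of_lt (lintegral_mono hbound) ?_
  rw [lintegral_add_left (Finset.measurable_sum _ fun x _ =>
    (continuous_eval_const x).measurable.enorm)]
  refine ENNReal.add_lt_top.2 ⟨?_, (hle h).trans_lt hωh⟩
  rw [lintegral_finsetSum _ fun x _ => (continuous_eval_const x).measurable.enorm]
  exact ENNReal.sum_lt_top.2 fun x _ => (hμ.integrable_eval x).2

lemma IsGP.hasGaussianLaw_comp (hμ : IsGP μ k) {ι : Type*} [Fintype ι] (x : ι → X) :
    HasGaussianLaw (fun (f : C(X, ℝ)) i => f (x i)) μ := by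
  let L : ({i // i ∈ (Finset.univ : Finset ι)} → ℝ) →L[ℝ] (ι → ℝ) :=
    ContinuousLinearMap.pi fun i => ContinuousLinearMap.proj ⟨i, Finset.mem_univ i⟩
  exact ((hμ.gaussian.comp_right x).hasGaussianLaw Finset.univ).map_fun L

lemma IsGP.kernel_symm (hμ : IsGP μ k) (x x' : X) : k x x' = k x' x := by
  rw [← hμ.cov, ← hμ.cov, covariance_comm]

lemma IsGP.kernel_le (hμ : IsGP μ k) {s : ℝ} (hs : ∀ x, k x x = s) (x x' : X) : k x x' ≤ s := by
  have := hμ.gaussian.isProbabilityMeasure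
  have hL2 : ∀ x, MemLp (fun f : C(X, ℝ) => f x) 2 μ := fun x =>
    (hμ.gaussian.hasGaussianLaw_eval x).memLp_two
  have hv : ∀ x, Var[fun f : C(X, ℝ) => f x; μ] = s := fun x => by
    rw [← covariance_self (hL2 x).aestronglyMeasurable.aemeasurable, hμ.cov, hs]
  have h := variance_nonneg ((fun f : C(X, ℝ) => f x) - fun f => f x') μ
  rw [variance_sub (hL2 x) (hL2 x'), hv, hv, hμ.cov] at h
  linarith

/-- The kernel condition bounds the squared increments of the rewards by those of the process. -/
lemma IsGP.sq_sub_le_of_kernelCondition (hμ : IsGP μ k) {s : ℝ} (hs : ∀ x, k x x = s)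
    (hs0 : 0 < s) {Y : Set C(X, ℝ)} {β C : ℝ} (hcond : KernelCondition Y k C)
    (hβ : ∀ y ∈ Y, ∀ x, |y x| ≤ β) {y : C(X, ℝ)} (hy : y ∈ Y) (x x' : X) :
    (y x - y x') ^ 2 / 2 ≤ β * (β + C) / s * (s - k x x') := by
  wlog h : y x' ≤ y x generalizing x x'
  · have := this x' x (le_of_not_ge h)
    rw [hμ.kernel_symm x' x] at this
    linarith [this, sub_sq_comm (y x) (y x')]
  have h1 := hcond x x' y hy
  have hk := hμ.kernel_le hs x x'
  rw [hs] at h1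
  set r := k x x' / s with hr
  have hr1 : 0 ≤ 1 - r := sub_nonneg.2 (div_le_one_of_le₀ hk hs0.le)
  have b1 := abs_le.1 (hβ y hy x)
  have b2 := abs_le.1 (hβ y hy x')
  have h2 : y x - y x' ≤ (β + C) * (1 - r) := by nlinarith
  have e : β * (β + C) / s * (s - k x x') = β * ((β + C) * (1 - r)) := by
    rw [hr]
    field_simp
  rw [e]
  have hβ0 : 0 ≤ β := (abs_nonneg _).trans (hβ y hy x)
  calc (y x - y x') ^ 2 / 2 = (y x - y x') / 2 * (y x - y x') := by ring
    _ ≤ β * (y x - y x') := mul_le_mul_of_nonneg_right (by linarith) (by linarith)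
    _ ≤ _ := mul_le_mul_of_nonneg_left h2 hβ0

end Prior

/-! ### The Gaussian-smoothed supremum -/

section Potential

variable {X : Type*} [MetricSpace X] {μ : Measure C(X, ℝ)} {k : X → X → ℝ}

/-- The expected supremum `E sup (f + c γ)` of a function perturbed by the prior at scale `c`. -/
def potential (μ : Measure C(X, ℝ)) (c : ℝ) (f : C(X, ℝ)) : ℝ := ∫ g, supVal (f + c • g) ∂μ

lemma potential_zero_right {c : ℝ} (hc : 0 ≤ c) :
    potential μ c 0 = c * ∫ g, supVal g ∂μ := by
  simp only [potential, zero_add, supVal_smul hc]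
  exact integral_const_mul _ _

variable [IsProbabilityMeasure μ]

lemma potential_zero_left (f : C(X, ℝ)) : potential μ 0 f = supVal f := by simp [potential]

variable [CompactSpace X] [Nonempty X]

lemma integrable_supVal_add_smul (hn : Integrable (fun f : C(X, ℝ) => ‖f‖) μ) (c : ℝ)
    (f : C(X, ℝ)) : Integrable (fun g => supVal (f + c • g)) μ := by
  refine ((integrable_const ‖f‖).add (hn.const_mul |c|)).mono'
    (continuous_supVal.comp (by fun_prop)).aestronglyMeasurable (ae_of_all _ fun g => ?_)
  refine (abs_supVal_le _).trans ((norm_add_le _ _).trans ?_)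
  simp [norm_smul]

lemma integrable_supVal (hn : Integrable (fun f : C(X, ℝ) => ‖f‖) μ) : Integrable supVal μ := by
  simpa using integrable_supVal_add_smul hn 1 0

lemma abs_potential_sub_le (hn : Integrable (fun f : C(X, ℝ) => ‖f‖) μ) (c : ℝ)
    (f f' : C(X, ℝ)) : |potential μ c f - potential μ c f'| ≤ ‖f - f'‖ := by
  rw [potential, potential, ← integral_sub (integrable_supVal_add_smul hn c f)
    (integrable_supVal_add_smul hn c f')]
  have h := norm_integral_le_of_norm_le_const (μ := μ) (C := ‖f - f'‖)
    (f := fun g => supVal (f + c • g) - supVal (f' + c • g)) (ae_of_all _ fun g => by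
      simpa using abs_supVal_sub_le (f + c • g) (f' + c • g))
  simpa using h

lemma continuous_potential (hn : Integrable (fun f : C(X, ℝ) => ‖f‖) μ) (c : ℝ) :
    Continuous (potential μ c) :=
  (LipschitzWith.of_dist_le_mul (K := 1) fun f g => by
    simpa [Real.dist_eq, dist_eq_norm] using abs_potential_sub_le hn c f g).continuous

/-- Jensen's inequality: perturbing by a centered random function increases the expected
supremum. -/
lemma supVal_le_potential (hμ : IsGP μ k) (hn : Integrable (fun f : C(X, ℝ) => ‖f‖) μ) (c : ℝ)
    (f : C(X, ℝ)) : supVal f ≤ potential μ c f := by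
  refine supVal_le fun x => ?_
  have h1 : ∫ g : C(X, ℝ), (f x + c * g x) ∂μ = f x := by
    rw [integral_add (integrable_const _) ((hμ.integrable_eval x).const_mul c),
      integral_const_mul, hμ.mean]
    simp
  rw [← h1]
  refine integral_mono ((integrable_const _).add ((hμ.integrable_eval x).const_mul c))
    (integrable_supVal_add_smul hn c f) fun g => ?_
  simpa using le_supVal (f + c • g) x

lemma integral_supVal_nonneg (hμ : IsGP μ k) (hn : Integrable (fun f : C(X, ℝ) => ‖f‖) μ) :
    0 ≤ ∫ g, supVal g ∂μ := by
  have := supVal_le_potential hμ hn 1 0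
  rwa [supVal_zero, potential_zero_right zero_le_one, one_mul] at this

/-- The potential increases with the scale of the perturbation, being convex in the scale and
minimal at scale zero. -/
lemma potential_mono (hμ : IsGP μ k) (hn : Integrable (fun f : C(X, ℝ) => ‖f‖) μ) {c c' : ℝ}
    (hc : 0 ≤ c) (hcc' : c ≤ c') (f : C(X, ℝ)) : potential μ c f ≤ potential μ c' f := by
  rcases hc.eq_or_lt with rfl | hc0
  · rw [potential_zero_left]
    exact supVal_le_potential hμ hn c' f
  have hc' : 0 < c' := hc0.trans_le hcc'
  set r := c / c' with hr
  have hr0 : 0 ≤ r := by positivity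
  have hr1 : r ≤ 1 := (div_le_one hc').2 hcc'
  have hle : ∀ g, supVal (f + c • g) ≤ (1 - r) * supVal f + r * supVal (f + c' • g) := fun g => by
    refine supVal_le fun x => ?_
    have h1 := mul_le_mul_of_nonneg_left (le_supVal f x) (sub_nonneg.2 hr1)
    have h2 := mul_le_mul_of_nonneg_left (le_supVal (f + c' • g) x) hr0
    have e : (f + c • g) x = (1 - r) * f x + r * (f + c' • g) x := by
      simp only [ContinuousMap.add_apply, ContinuousMap.smul_apply, smul_eq_mul, hr]
      field_simp
      ring
    rw [e]
    exact add_le_add h1 h2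
  have h1 : potential μ c f ≤ (1 - r) * supVal f + r * potential μ c' f := by
    have := integral_mono (integrable_supVal_add_smul hn c f)
      ((integrable_const ((1 - r) * supVal f)).add
        ((integrable_supVal_add_smul hn c' f).const_mul r)) hle
    refine this.trans_eq ?_
    simp only [Pi.add_apply]
    rw [integral_add (integrable_const _) ((integrable_supVal_add_smul hn c' f).const_mul r),
      integral_const_mul r]
    simp [potential]
  have h2 := mul_le_mul_of_nonneg_left (supVal_le_potential hμ hn c' f) (sub_nonneg.2 hr1)
  linarith

/-- Semiconcavity of the potential in directions whose squared increments are controlled by the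
covariance kernel, as a limit of the finite-dimensional statement. -/
lemma concaveOn_potential (hμ : IsGP μ k) (hn : Integrable (fun f : C(X, ℝ) => ‖f‖) μ) {s : ℝ}
    (hs : ∀ x, k x x = s) (hs0 : s ≠ 0) {c B : ℝ} (hc : 0 < c) (hB : 0 ≤ B) (f : C(X, ℝ))
    {y : C(X, ℝ)} (hy : ∀ x x', (y x - y x') ^ 2 / 2 ≤ B * (s - k x x')) :
    ConcaveOn ℝ Set.univ (fun u : ℝ => potential μ c (f + u • y)
      - B / c * (∫ g, supVal g ∂μ) / 2 * u ^ 2) := by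
  let x : ∀ m : ℕ, Fin (m + 1) → X := fun m i => TopologicalSpace.denseSeq X i
  let φ : ℕ → ℝ → ℝ := fun m u =>
    ∫ g : C(X, ℝ), smoothMax (((m : ℝ) + 1) ^ 2) (fun i => (f + u • y + c • g) (x m i)) ∂μ
  have hφ : ∀ m, ConcaveOn ℝ Set.univ
      (fun u => φ m u - B / c * (∫ g, supVal g ∂μ) / 2 * u ^ 2) := fun m => by
    have := concaveOn_integral_smoothMax (θ := ((m : ℝ) + 1) ^ 2)
      (K := fun i j => k (x m i) (x m j)) (hμ.hasGaussianLaw_comp (x m))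
      (fun i => hμ.mean _) (fun i j => hμ.cov _ _) (fun i => hs _) hs0 (by positivity) hc hB
      (a := fun i => f (x m i)) (y := fun i => y (x m i)) (fun i j => hy _ _)
      (integrable_supVal hn) (fun g i => le_supVal g _)
    convert this using 6 with u g
    ext i
    simp only [ContinuousMap.add_apply, ContinuousMap.smul_apply, Pi.add_apply, Pi.smul_apply]
    ring
  have hlim : ∀ u, Filter.Tendsto (fun m => φ m u - B / c * (∫ g, supVal g ∂μ) / 2 * u ^ 2)
      Filter.atTop (nhds (potential μ c (f + u • y) -
        B / c * (∫ g, supVal g ∂μ) / 2 * u ^ 2)) := fun u => by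
    refine Filter.Tendsto.sub_const ?_ _
    refine tendsto_integral_of_dominated_convergence
      (fun g => (‖f + u • y‖ + |c| * ‖g‖) + 1) (fun m => ?_)
      (((integrable_const _).add (hn.const_mul _)).add (integrable_const _))
      (fun m => ae_of_all _ fun g => ?_) (ae_of_all _ fun g => tendsto_smoothMax_denseSeq _)
    · refine ((continuous_smoothMax _).comp (continuous_pi fun i => ?_)).aestronglyMeasurable
      exact (continuous_eval_const _).comp (by fun_prop)
    · refine (abs_smoothMax_denseSeq_le _ m).trans (add_le_add_left ?_ 1)
      refine (norm_add_le _ _).trans ?_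
      simp [norm_smul]
  refine ⟨convex_univ, fun u _ v _ a b ha hb hab => ?_⟩
  exact le_of_tendsto_of_tendsto (((hlim u).const_smul a).add ((hlim v).const_smul b))
    (hlim _) (.of_forall fun m => (hφ m).2 trivial trivial ha hb hab)

/-- A semiconcave function that lies above an affine minorant touching it at `0` exceeds this
minorant at `1` by at most half the semiconcavity constant. -/
lemma le_of_concaveOn_sub_sq {φ : ℝ → ℝ} {L d : ℝ}
    (hφ : ConcaveOn ℝ Set.univ (fun u => φ u - L / 2 * u ^ 2)) (hd : ∀ u, φ 0 + u * d ≤ φ u) :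
    φ 1 ≤ φ 0 + d + L / 2 := by
  -- `0` is the average of `1` and `-ε` with weights proportional to `ε` and `1`
  have key : ∀ ε : ℝ, 0 < ε → φ 1 ≤ φ 0 + d + L / 2 + L / 2 * ε := fun ε hε => by
    have h := hφ.2 (Set.mem_univ (1 : ℝ)) (Set.mem_univ (-ε))
      (show 0 ≤ ε / (1 + ε) by positivity) (show 0 ≤ 1 / (1 + ε) by positivity)
      (by field_simp; ring)
    have e : (ε / (1 + ε)) • (1 : ℝ) + (1 / (1 + ε)) • (-ε) = 0 := by
      simp only [smul_eq_mul]
      ring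
    rw [e] at h
    simp only [smul_eq_mul] at h
    have h2 := mul_le_mul_of_nonneg_left h (show 0 ≤ 1 + ε by positivity)
    have e2 : (1 + ε) * (ε / (1 + ε) * (φ 1 - L / 2 * 1 ^ 2) +
        1 / (1 + ε) * (φ (-ε) - L / 2 * (-ε) ^ 2)) =
        ε * (φ 1 - L / 2) + (φ (-ε) - L / 2 * ε ^ 2) := by
      field_simp
    rw [e2] at h2
    have h3 := hd (-ε)
    have h4 : ε * φ 1 ≤ ε * (φ 0 + d + L / 2 + L / 2 * ε) := by nlinarith
    exact le_of_mul_le_mul_left h4 hε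
  have hlim : Filter.Tendsto (fun ε : ℝ => φ 0 + d + L / 2 + L / 2 * ε)
      (nhdsWithin 0 (Set.Ioi 0)) (nhds (φ 0 + d + L / 2)) := by
    have : Continuous fun ε : ℝ => φ 0 + d + L / 2 + L / 2 * ε := by fun_prop
    simpa using (this.tendsto 0).mono_left nhdsWithin_le_nhds
  exact ge_of_tendsto hlim (by filter_upwards [self_mem_nhdsWithin] with ε hε using key ε hε)

variable [MeasurableSpace X] [BorelSpace X]

/-- One round of the game: adding a reward `y` raises the potential by at most the expected reward
of the perturbed leader, which is a subgradient of the potential, plus a second-order term. -/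
lemma potential_add_le (hμ : IsGP μ k) (hn : Integrable (fun f : C(X, ℝ) => ‖f‖) μ) {s : ℝ}
    (hs : ∀ x, k x x = s) (hs0 : s ≠ 0) {c B : ℝ} (hc : 0 < c) (hB : 0 ≤ B) (f : C(X, ℝ))
    {y : C(X, ℝ)} (hy : ∀ x x', (y x - y x') ^ 2 / 2 ≤ B * (s - k x x'))
    {α : C(X, ℝ) → X} (hα : IsTieBreakingRule α) (hαm : Measurable α) :
    potential μ c (f + y) ≤ potential μ c f + ∫ g, y (α (f + c • g)) ∂μ +
      B / c * (∫ g, supVal g ∂μ) / 2 := by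
  have h := le_of_concaveOn_sub_sq (φ := fun u => potential μ c (f + u • y))
    (L := B / c * (∫ g, supVal g ∂μ)) (d := ∫ g, y (α (f + c • g)) ∂μ)
    (concaveOn_potential hμ hn hs hs0 hc hB f hy) ?_
  · simpa using h
  intro u
  have hym : Measurable fun g : C(X, ℝ) => y (α (f + c • g)) :=
    y.continuous.measurable.comp (hαm.comp (by fun_prop : Continuous _).measurable)
  have hyi : Integrable (fun g : C(X, ℝ) => y (α (f + c • g))) μ :=
    Integrable.of_bound hym.aestronglyMeasurable ‖y‖
      (ae_of_all _ fun g => y.norm_coe_le_norm _)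
  simp only [zero_smul, add_zero, potential]
  rw [← integral_const_mul, ← integral_add (integrable_supVal_add_smul hn c f) (hyi.const_mul u)]
  refine integral_mono ((integrable_supVal_add_smul hn c f).add (hyi.const_mul u))
    (integrable_supVal_add_smul hn c _) fun g => ?_
  have h1 := le_supVal (f + u • y + c • g) (α (f + c • g))
  simp only
  rw [supVal_eq_of_isTieBreakingRule hα (f + c • g)]
  simp only [ContinuousMap.add_apply, ContinuousMap.smul_apply, smul_eq_mul] at h1 ⊢
  linarith

end Potential

/-! ### The law of a sum of independent copies of the prior -/

section SumLaw

variable {X : Type*} [MetricSpace X] [CompactSpace X]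

/-- Finite measures on `C(X, ℝ)` are determined by their finite-dimensional marginals: restriction
to a dense sequence embeds `C(X, ℝ)` measurably into `ℕ → ℝ`. -/
lemma measure_ext_of_marginals [Nonempty X] {μ ν : Measure C(X, ℝ)} [IsFiniteMeasure μ]
    [IsFiniteMeasure ν]
    (h : ∀ (I : Finset ℕ) (x : I → X),
      μ.map (fun f i => f (x i)) = ν.map (fun f i => f (x i))) : μ = ν := by
  let e : C(X, ℝ) → ℕ → ℝ := fun f n => f (TopologicalSpace.denseSeq X n)
  have he : Continuous e := continuous_pi fun n => continuous_eval_const _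
  have hinj : Function.Injective e := fun f g hfg => by
    refine DFunLike.coe_injective ?_
    refine (TopologicalSpace.denseRange_denseSeq X).equalizer f.continuous g.continuous ?_
    exact hfg
  have hme : MeasurableEmbedding e := he.measurableEmbedding hinj
  have hmap : ∀ (ρ : Measure C(X, ℝ)) (I : Finset ℕ), (ρ.map e).map I.restrict =
      ρ.map (fun f (i : I) => f (TopologicalSpace.denseSeq X i)) := fun ρ I =>
    Measure.map_map (Finset.measurable_restrict I) he.measurable
  have key : μ.map e = ν.map e :=
    IsProjectiveLimit.unique (P := fun I : Finset ℕ => (μ.map e).map I.restrict)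
      (fun _ => rfl) fun I =>
        (hmap ν I).trans ((h I _).symm.trans (hmap μ I).symm)
  exact hme.map_injective key

variable {μ : Measure C(X, ℝ)} [IsProbabilityMeasure μ] {k : X → X → ℝ}

/-- The sum of `n` independent copies of a centered Gaussian process has the law of one copy scaled
by `√n`. -/
lemma IsGP.map_sum_pi [Nonempty X] (hμ : IsGP μ k) {T : ℕ} (s : Finset (Fin T)) :
    (Measure.pi fun _ : Fin T => μ).map (fun γ => ∑ τ ∈ s, γ τ) =
      μ.map (fun g => √(s.card : ℝ) • g) := by
  have hsum : Measurable fun γ : Fin T → C(X, ℝ) => ∑ τ ∈ s, γ τ := by fun_prop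
  have hsmul : Measurable fun g : C(X, ℝ) => √(s.card : ℝ) • g :=
    (by fun_prop : Continuous fun g : C(X, ℝ) => √(s.card : ℝ) • g).measurable
  have := Measure.isProbabilityMeasure_map (μ := Measure.pi fun _ : Fin T => μ) hsum.aemeasurable
  have := Measure.isProbabilityMeasure_map (μ := μ) hsmul.aemeasurable
  refine measure_ext_of_marginals fun I x => ?_
  let ev : C(X, ℝ) → I → ℝ := fun f i => f (x i)
  have hev : Measurable ev := (continuous_pi fun i => continuous_eval_const _).measurable
  have hG : HasGaussianLaw ev μ := hμ.hasGaussianLaw_comp x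
  change Measure.map ev _ = Measure.map ev _
  rw [Measure.map_map hev hsum, Measure.map_map hev hsmul]
  have := Measure.isProbabilityMeasure_map (μ := Measure.pi fun _ : Fin T => μ)
    (hev.comp hsum).aemeasurable
  have := Measure.isProbabilityMeasure_map (μ := μ) (hev.comp hsmul).aemeasurable
  refine Measure.ext_of_charFunDual (funext fun L => ?_)
  have hmean : ∫ f, L (ev f) ∂μ = 0 := by
    have hi : Integrable ev μ := hG.integrable
    rw [L.integral_comp_comm hi]
    have : ∫ f, ev f ∂μ = 0 := by
      ext i
      exact (eval_integral (fun i => hμ.integrable_eval (x i)) i).trans (hμ.mean _)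
    rw [this, map_zero]
  have e1 : (ev ∘ fun γ : Fin T → C(X, ℝ) => ∑ τ ∈ s, γ τ) = ∑ τ ∈ s, fun γ => ev (γ τ) := by
    ext γ i
    simp [ev]
  have e2 : (ev ∘ fun g => √(s.card : ℝ) • g) = √(s.card : ℝ) • ev := by
    ext g i
    simp [ev]
  have hlaw : ∀ τ : Fin T, (Measure.pi fun _ : Fin T => μ).map (fun γ => ev (γ τ)) =
      μ.map ev := fun τ => by
    conv_rhs => rw [← (measurePreserving_eval (fun _ : Fin T => μ) τ).map_eq,
      Measure.map_map hev (measurable_pi_apply τ)]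
    rfl
  have hind : iIndepFun (fun τ (γ : Fin T → C(X, ℝ)) => ev (γ τ))
      (Measure.pi fun _ : Fin T => μ) := iIndepFun_pi fun _ => hev.aemeasurable
  rw [e1, e2, iIndepFun.charFunDual_map_finsetSum_eq_prod
    (X := fun τ (γ : Fin T → C(X, ℝ)) => ev (γ τ))
    (fun τ _ => (hev.comp (measurable_pi_apply τ)).aemeasurable) (hind.restrict _),
    Finset.prod_congr rfl fun τ _ => by rw [hlaw τ], Finset.prod_const]
  have h2 := (hG.smul √(s.card : ℝ)).charFunDual_map_eq L
  have h1 := hG.charFunDual_map_eq L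
  have v2 : Var[L ∘ (√(s.card : ℝ) • ev); μ] = s.card * Var[L ∘ ev; μ] := by
    have : L ∘ (√(s.card : ℝ) • ev) = √(s.card : ℝ) • (L ∘ ev) := by
      ext f
      simp
    rw [this, variance_smul, Real.sq_sqrt (Nat.cast_nonneg _)]
  have m2 : μ[L ∘ (√(s.card : ℝ) • ev)] = 0 := by
    have : (L ∘ (√(s.card : ℝ) • ev)) = fun f => √(s.card : ℝ) * L (ev f) := by
      ext f
      simp
    rw [this, integral_const_mul, hmean, mul_zero]
  have m1 : μ[L ∘ ev] = 0 := hmean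
  rw [Pi.pow_apply, h1, h2, m1, m2, v2, ← Complex.exp_nat_mul]
  congr 1
  push_cast
  ring

end SumLaw

/-! ### The game -/

section GameLaw

variable {X : Type*} [MetricSpace X]

/-- The sum of the reward functions of a history. -/
def cumReward {t : ℕ} (h : History X t) : C(X, ℝ) := ∑ s, (h s).2

/-- The reward that the learner has collected along a history. -/
def collected {t : ℕ} (h : History X t) : ℝ := ∑ s, (h s).2 (h s).1

lemma cumReward_snoc {t : ℕ} (h : History X t) (z : X × C(X, ℝ)) :
    cumReward (Fin.snoc h z : History X (t + 1)) = cumReward h + z.2 := by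
  simp [cumReward, Fin.sum_univ_castSucc]

lemma collected_snoc {t : ℕ} (h : History X t) (z : X × C(X, ℝ)) :
    collected (Fin.snoc h z : History X (t + 1)) = collected h + z.2 z.1 := by
  simp [collected, Fin.sum_univ_castSucc]

lemma realizedRegret_eq {T : ℕ} (h : History X T) :
    realizedRegret h = supVal (cumReward h) - collected h := by
  simp [realizedRegret, supVal, cumReward, collected]

variable [MeasurableSpace X]

lemma measurable_snoc (t : ℕ) : Measurable fun z : History X t × (X × C(X, ℝ)) =>
    (Fin.snoc z.1 z.2 : History X (t + 1)) := by
  refine measurable_pi_lambda _ fun i => ?_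
  refine Fin.lastCases ?_ (fun j => ?_) i
  · simpa using measurable_snd
  · simpa using! (measurable_pi_apply j).comp measurable_fst

instance isMarkovKernel_adversaryResponse (p : LearnerStrategy X) (q : AdversaryStrategy X)
    [∀ t, IsMarkovKernel (q t)] (t : ℕ) : IsMarkovKernel (adversaryResponse p q t) := by
  unfold adversaryResponse
  infer_instance

lemma isProbabilityMeasure_playLaw (p : LearnerStrategy X) (q : AdversaryStrategy X)
    [∀ t, IsMarkovKernel (p t)] [∀ t, IsMarkovKernel (q t)] (t : ℕ) :
    IsProbabilityMeasure (playLaw p q t) := by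
  induction t with
  | zero => exact Measure.dirac.isProbabilityMeasure
  | succ t ih => exact Measure.isProbabilityMeasure_map (measurable_snoc t).aemeasurable

variable [CompactSpace X]

lemma measurable_cumReward (t : ℕ) : Measurable (cumReward : History X t → C(X, ℝ)) :=
  Finset.measurable_fun_sum _ fun s _ => measurable_snd.comp (measurable_pi_apply s)

/-- All rewards of the game obey the uniform bound that holds on the adversary's set. -/
lemma ae_playLaw_norm_le (p : LearnerStrategy X) (q : AdversaryStrategy X)
    [∀ t, IsMarkovKernel (p t)] [∀ t, IsMarkovKernel (q t)] {β : ℝ}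
    (hq : ∀ t h, ∀ᵐ y ∂(q t h), ‖y‖ ≤ β) (t : ℕ) :
    ∀ᵐ h ∂(playLaw p q t), ∀ s, ‖(h s).2‖ ≤ β := by
  induction t with
  | zero => exact ae_of_all _ fun h s => s.elim0
  | succ t ih =>
    have := isProbabilityMeasure_playLaw p q t
    have hms : MeasurableSet {y : C(X, ℝ) | ‖y‖ ≤ β} :=
      (isClosed_le continuous_norm continuous_const).measurableSet
    have hm : ∀ t, MeasurableSet {h : History X t | ∀ s, ‖(h s).2‖ ≤ β} := fun t => by
      rw [Set.ofPred_forall]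
      exact MeasurableSet.iInter fun s =>
        (measurable_snd.comp (measurable_pi_apply s)) hms
    rw [playLaw, ae_map_iff (measurable_snoc t).aemeasurable (hm _)]
    refine (Measure.ae_compProd_iff (measurable_snoc t (hm _))).2 ?_
    filter_upwards [ih] with h hh
    rw [Kernel.prod_apply]
    have h2 : ∀ᵐ y ∂(adversaryResponse p q t h), ‖y‖ ≤ β := hq t (h, p t h)
    filter_upwards [Measure.quasiMeasurePreserving_snd.ae h2] with z hz
    refine Fin.lastCases ?_ fun j => ?_
    · simpa using hz
    · simpa using hh j

lemma measurable_collected [BorelSpace X] (t : ℕ) : Measurable (collected : History X t → ℝ) := by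
  have he : Measurable fun z : X × C(X, ℝ) => z.2 z.1 :=
    (by fun_prop : Continuous fun z : X × C(X, ℝ) => z.2 z.1).measurable
  exact Finset.measurable_fun_sum _ fun s _ => he.comp (measurable_pi_apply s)

end GameLaw

section Thompson

variable {X : Type*} [MetricSpace X] [CompactSpace X] [MeasurableSpace X]
  {μ : Measure C(X, ℝ)} [IsProbabilityMeasure μ] {k : X → X → ℝ} {α : C(X, ℝ) → X}

lemma isMarkovKernel_thompsonSampling {T : ℕ} (hαm : Measurable α)
    (post : ∀ t : ℕ, Kernel (Fin t → C(X, ℝ)) (Fin T → C(X, ℝ)))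
    [∀ t, IsMarkovKernel (post t)] (t : ℕ) :
    IsMarkovKernel (thompsonSampling α post t) := by
  have hm : Measurable fun γ : Fin T → C(X, ℝ) => α (∑ τ, γ τ) :=
    hαm.comp (Finset.measurable_fun_sum _ fun τ _ => measurable_pi_apply τ)
  have := Kernel.IsMarkovKernel.map (post t) hm
  unfold thompsonSampling
  infer_instance

instance isMarkovKernel_independentPosterior {T : ℕ} (t : ℕ) : IsMarkovKernel
    (independentPosterior (Measure.pi fun _ : Fin T => μ) t) :=
  Kernel.IsMarkovKernel.map _ measurable_splice

/-- In round `t`, with `n` rounds to go, Thompson sampling follows the leader after perturbing the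
observed cumulative reward by the prior at scale `√n`. -/
lemma thompsonSampling_apply [Nonempty X] (hμ : IsGP μ k) (hαm : Measurable α) (t n : ℕ)
    (h : History X t) :
    thompsonSampling α (independentPosterior (Measure.pi fun _ : Fin (t + n) => μ)) t h =
      μ.map (fun g => α (cumReward h + √(n : ℝ) • g)) := by
  have hm : Measurable fun γ : Fin (t + n) → C(X, ℝ) => α (∑ τ, γ τ) :=
    hαm.comp (Finset.measurable_fun_sum _ fun τ _ => measurable_pi_apply τ)
  have hmadd : Measurable fun S : C(X, ℝ) => α (cumReward h + S) :=
    hαm.comp (measurable_const_add _)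
  have hsmul : Measurable fun g : C(X, ℝ) => √(n : ℝ) • g :=
    (by fun_prop : Continuous fun g : C(X, ℝ) => √(n : ℝ) • g).measurable
  let s : Finset (Fin (t + n)) := Finset.univ.map (Fin.natAddEmb t)
  have hs : s.card = n := by simp [s]
  have hsum : Measurable fun γ : Fin (t + n) → C(X, ℝ) => ∑ τ ∈ s, γ τ :=
    Finset.measurable_fun_sum _ fun τ _ => measurable_pi_apply τ
  have hlaw := hμ.map_sum_pi s
  rw [hs] at hlaw
  rw [thompsonSampling, Kernel.comap_apply, Kernel.map_apply _ hm, independentPosterior,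
    Kernel.map_apply _ measurable_splice, Kernel.prod_apply, Kernel.id_apply, Kernel.const_apply,
    Measure.dirac_prod, Measure.map_map measurable_splice measurable_prodMk_left,
    Measure.map_map hm (measurable_splice.comp measurable_prodMk_left)]
  have e : ((fun γ : Fin (t + n) → C(X, ℝ) => α (∑ τ, γ τ)) ∘
      (fun z : (Fin t → C(X, ℝ)) × (Fin (t + n) → C(X, ℝ)) => splice z.1 z.2) ∘
        Prod.mk fun i => (h i).2) =
      (fun S => α (cumReward h + S)) ∘ fun γ => ∑ τ ∈ s, γ τ := by
    ext γ
    simp only [Function.comp, s, Finset.sum_map, Fin.sum_univ_add, cumReward]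
    simp [splice]
  rw [e, ← Measure.map_map hmadd hsum, hlaw, Measure.map_map hmadd hsmul]
  rfl

end Thompson

/-! ### The regret bound -/

section Regret

variable {X : Type*} [MetricSpace X] {μ : Measure C(X, ℝ)}

/-- The value of a history with `n` rounds to go: the potential of the cumulative reward at scale
`√n`, minus the collected reward. With no rounds to go it is the realized regret. -/
def gameValue (μ : Measure C(X, ℝ)) (n : ℕ) {t : ℕ} (h : History X t) : ℝ :=
  potential μ √(n : ℝ) (cumReward h) - collected h

lemma gameValue_zero [IsProbabilityMeasure μ] {T : ℕ} (h : History X T) :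
    gameValue μ 0 h = realizedRegret h := by
  rw [gameValue, Nat.cast_zero, Real.sqrt_zero, potential_zero_left, realizedRegret_eq]

variable [CompactSpace X] [Nonempty X] [MeasurableSpace X] [BorelSpace X]
  [IsProbabilityMeasure μ] {k : X → X → ℝ} {α : C(X, ℝ) → X}
  {p : LearnerStrategy X} {q : AdversaryStrategy X}

lemma measurable_gameValue (hn : Integrable (fun f : C(X, ℝ) => ‖f‖) μ) (n t : ℕ) :
    Measurable (gameValue μ n : History X t → ℝ) :=
  ((continuous_potential hn _).measurable.comp (measurable_cumReward t)).sub
    (measurable_collected t)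

lemma integrable_gameValue (hn : Integrable (fun f : C(X, ℝ) => ‖f‖) μ)
    [∀ t, IsMarkovKernel (p t)] [∀ t, IsMarkovKernel (q t)] {β : ℝ}
    (hq : ∀ t h, ∀ᵐ y ∂(q t h), ‖y‖ ≤ β) (n t : ℕ) :
    Integrable (gameValue μ n) (playLaw p q t) := by
  have := isProbabilityMeasure_playLaw p q t
  refine Integrable.of_bound (measurable_gameValue hn n t).aestronglyMeasurable
    (|potential μ √(n : ℝ) 0| + t * β + t * β) ?_
  filter_upwards [ae_playLaw_norm_le p q hq t] with h hh
  have h1 : ‖cumReward h‖ ≤ t * β := by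
    refine (norm_sum_le _ _).trans ((Finset.sum_le_sum fun s _ => hh s).trans ?_)
    simp
  have h2 : |collected h| ≤ t * β := by
    refine (Finset.abs_sum_le_sum_abs _ _).trans ((Finset.sum_le_sum fun s _ =>
      ((h s).2.norm_coe_le_norm _).trans (hh s)).trans ?_)
    simp
  have h3 := abs_potential_sub_le hn √(n : ℝ) (cumReward h) 0
  rw [sub_zero] at h3
  have h4 := abs_sub_abs_le_abs_sub (potential μ √(n : ℝ) (cumReward h)) (potential μ √(n : ℝ) 0)
  rw [Real.norm_eq_abs, gameValue]
  refine (abs_sub _ _).trans ?_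
  linarith

/-- In one round the expected value of the game increases by at most a second-order term, which
telescopes in the square root of the number of rounds to go. -/
lemma integral_gameValue_succ_le (hμ : IsGP μ k) (hn : Integrable (fun f : C(X, ℝ) => ‖f‖) μ)
    {s : ℝ} (hs : ∀ x, k x x = s) (hs0 : s ≠ 0) (hα : IsTieBreakingRule α) (hαm : Measurable α)
    [∀ t, IsMarkovKernel (p t)] [∀ t, IsMarkovKernel (q t)] {β B : ℝ} (hB : 0 ≤ B)
    (hq : ∀ t h, ∀ᵐ y ∂(q t h), ‖y‖ ≤ β)
    (hqB : ∀ t h, ∀ᵐ y ∂(q t h), ∀ x x', (y x - y x') ^ 2 / 2 ≤ B * (s - k x x')) {n t : ℕ}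
    (hp : ∀ h, p t h = μ.map (fun g => α (cumReward h + √((n + 1 : ℕ) : ℝ) • g))) :
    ∫ h, gameValue μ n h ∂(playLaw p q (t + 1)) ≤ ∫ h, gameValue μ (n + 1) h ∂(playLaw p q t) +
      B * (∫ g, supVal g ∂μ) * (√((n + 1 : ℕ) : ℝ) - √(n : ℝ)) := by
  have := isProbabilityMeasure_playLaw p q t
  have hE := integral_supVal_nonneg hμ hn
  set E := ∫ g, supVal g ∂μ
  set c := √((n + 1 : ℕ) : ℝ) with hc
  have hc0 : 0 < c := Real.sqrt_pos.2 (by positivity)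
  have hcn : √(n : ℝ) ≤ c := Real.sqrt_le_sqrt (by push_cast; linarith)
  -- `1 / (2 √(n + 1)) ≤ √(n + 1) - √n`
  have hstep : B / c * E / 2 ≤ B * E * (c - √(n : ℝ)) := by
    have h1 : c ^ 2 = n + 1 := by rw [hc, Real.sq_sqrt (by positivity)]; push_cast; ring
    have h2 : √(n : ℝ) ^ 2 = n := Real.sq_sqrt (by positivity)
    have h3 : 1 / c / 2 ≤ c - √(n : ℝ) := by
      rw [div_div, div_le_iff₀ (by positivity)]
      nlinarith [sq_nonneg (c - √(n : ℝ))]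
    calc B / c * E / 2 = B * E * (1 / c / 2) := by ring
      _ ≤ _ := mul_le_mul_of_nonneg_left h3 (mul_nonneg hB hE)
  have hint := integrable_gameValue (p := p) (q := q) hn hq n (t + 1)
  have hms : AEStronglyMeasurable (gameValue μ n : History X (t + 1) → ℝ)
      (playLaw p q (t + 1)) := hint.aestronglyMeasurable
  rw [playLaw] at hint hms ⊢
  have hint' : Integrable (fun z : History X t × (X × C(X, ℝ)) =>
      gameValue μ n (Fin.snoc z.1 z.2 : History X (t + 1)))
      (playLaw p q t ⊗ₘ (p t ×ₖ adversaryResponse p q t)) :=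
    (integrable_map_measure hms (measurable_snoc t).aemeasurable).1 hint
  rw [integral_map (measurable_snoc t).aemeasurable hms, Measure.integral_compProd hint']
  have hsec := ((Measure.integrable_compProd_iff hint'.aestronglyMeasurable).1 hint').1
  have houter : Integrable (fun h => ∫ z, gameValue μ n (Fin.snoc h z : History X (t + 1))
      ∂((p t ×ₖ adversaryResponse p q t) h)) (playLaw p q t) := by
    simpa using Integrable.integral_compProd hint'
  refine (integral_mono_ae houter
    ((integrable_gameValue (p := p) (q := q) hn hq (n + 1) t).add (integrable_const
      (B * E * (c - √(n : ℝ))))) ?_).trans_eq ?_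
  swap
  · simp only [Pi.add_apply]
    rw [integral_add (integrable_gameValue (p := p) (q := q) hn hq (n + 1) t)
      (integrable_const _)]
    simp
  filter_upwards [hsec] with h hh
  simp only [Pi.add_apply]
  rw [Kernel.prod_apply] at hh ⊢
  rw [integral_prod_symm _ hh]
  have hr : ∀ᵐ y ∂(adversaryResponse p q t h), ∫ x, gameValue μ n (Fin.snoc h (x, y) :
      History X (t + 1)) ∂(p t h) ≤ gameValue μ (n + 1) h + B * E * (c - √(n : ℝ)) := by
    have h1 : ∀ᵐ y ∂(adversaryResponse p q t h), ∀ x x',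
        (y x - y x') ^ 2 / 2 ≤ B * (s - k x x') := hqB t (h, p t h)
    filter_upwards [h1] with y hy
    have hyi : Integrable (fun x => y x) (p t h) :=
      Integrable.of_bound y.continuous.aestronglyMeasurable ‖y‖
        (ae_of_all _ fun x => y.norm_coe_le_norm x)
    have hym : Measurable fun g : C(X, ℝ) => α (cumReward h + c • g) :=
      hαm.comp (by fun_prop : Continuous fun g : C(X, ℝ) => cumReward h + c • g).measurable
    simp only [gameValue, cumReward_snoc, collected_snoc, sub_add_eq_sub_sub]
    rw [integral_sub (integrable_const _) hyi]
    simp only [integral_const, probReal_univ, one_smul]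
    rw [hp h, integral_map hym.aemeasurable y.continuous.aestronglyMeasurable]
    have h2 := potential_add_le hμ hn hs hs0 hc0 hB (cumReward h) hy hα hαm
    have h3 := potential_mono hμ hn (Real.sqrt_nonneg _) hcn (cumReward h + y)
    linarith
  refine (integral_mono_ae hh.integral_prod_right (integrable_const _) hr).trans_eq ?_
  simp

/-- The expected value of the game under Thompson sampling after `t` of `t + n` rounds. -/
lemma integral_gameValue_le (hμ : IsGP μ k) (hn : Integrable (fun f : C(X, ℝ) => ‖f‖) μ)
    {s : ℝ} (hs : ∀ x, k x x = s) (hs0 : s ≠ 0) (hα : IsTieBreakingRule α) (hαm : Measurable α)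
    [∀ t, IsMarkovKernel (p t)] [∀ t, IsMarkovKernel (q t)] {β B : ℝ} (hB : 0 ≤ B)
    (hq : ∀ t h, ∀ᵐ y ∂(q t h), ‖y‖ ≤ β)
    (hqB : ∀ t h, ∀ᵐ y ∂(q t h), ∀ x x', (y x - y x') ^ 2 / 2 ≤ B * (s - k x x')) {T : ℕ}
    (hp : p = thompsonSampling α (independentPosterior (Measure.pi fun _ : Fin T => μ)))
    {n t : ℕ} (ht : t + n = T) :
    ∫ h, gameValue μ n h ∂(playLaw p q t) ≤
      (√(T : ℝ) + B * (√(T : ℝ) - √(n : ℝ))) * ∫ g, supVal g ∂μ := by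
  induction t generalizing n with
  | zero =>
    obtain rfl : n = T := by omega
    rw [playLaw, integral_dirac' _ _ (measurable_gameValue hn n 0).stronglyMeasurable]
    simp [gameValue, cumReward, collected, potential_zero_right]
  | succ t ih =>
    have h1 := ih (n := n + 1) (by omega)
    have h2 := integral_gameValue_succ_le (n := n) (t := t) (p := p) (q := q) hμ hn hs hs0 hα hαm
      hB hq hqB (fun h => by
        obtain rfl : t + (n + 1) = T := by omega
        rw [hp, thompsonSampling_apply hμ hαm])
    refine (h2.trans (add_le_add_left h1 _)).trans_eq ?_
    ring

end Regret

end OnlineLearning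

end

theorem mainTheorem2 {d : ℕ} (X : Set (EuclideanSpace ℝ (Fin d))) (hX : IsCompact X)
    (hXne : X.Nonempty) (Y : Set C(X, ℝ)) (β : ℝ) (hβ : ∀ y ∈ Y, ∀ x, |y x| ≤ β)
    (k : X → X → ℝ) (hk_cont : Continuous fun z : X × X => k z.1 z.2)
    (hk_pos : OnlineLearning.IsStrictlyPositiveDefinite k)
    (σ : ℝ) (hk_var : ∀ x, k x x = σ ^ 2)
    (C : ℝ) (hC : 0 < C) (hk_cond : OnlineLearning.KernelCondition Y k C)
    (μ : Measure C(X, ℝ)) [IsProbabilityMeasure μ] (hμ : OnlineLearning.IsGP μ k)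
    (hμ_mod : OnlineLearning.HasExpectedModulus μ)
    (T : ℕ) (α : C(X, ℝ) → X) (hα : OnlineLearning.IsTieBreakingRule α) (hα_meas : Measurable α)
    (p : OnlineLearning.LearnerStrategy X)
    (hp : p = OnlineLearning.thompsonSampling α
      (OnlineLearning.independentPosterior (Measure.pi fun _ : Fin T => μ)))
    (q : OnlineLearning.AdversaryStrategy X) [∀ t, IsMarkovKernel (q t)]
    (hq : ∀ t h, ∀ᵐ y ∂(q t h), y ∈ Y) :
    Integrable (fun f : C(X, ℝ) => ⨆ x, f x) μ ∧
    Integrable OnlineLearning.realizedRegret (OnlineLearning.playLaw p q T) ∧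
    OnlineLearning.regret T p q ≤
      √T * (1 + β * (β + C) / σ ^ 2) * ∫ f, ⨆ x, f x ∂μ := by
  have : CompactSpace X := isCompact_iff_compactSpace.1 hX
  obtain ⟨x₀⟩ : Nonempty X := hXne.to_subtype
  have : Nonempty X := ⟨x₀⟩
  have hσ : 0 < σ ^ 2 := by
    have h := (hk_pos {x₀}).diag_pos (i := ⟨x₀, Finset.mem_singleton_self x₀⟩)
    rwa [Matrix.of_apply, hk_var] at h
  -- the adversary's set is nonempty because it carries a probability measure
  have hβ0 : 0 ≤ β := by
    obtain ⟨y, hy⟩ := (hq 0 (Fin.elim0, 0)).exists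
    exact (abs_nonneg _).trans (hβ y hy x₀)
  have hB : 0 ≤ β * (β + C) / σ ^ 2 := by positivity
  have hn := hμ.integrable_norm hμ_mod
  have hpM : ∀ t, IsMarkovKernel (p t) := fun t => by
    rw [hp]
    exact OnlineLearning.isMarkovKernel_thompsonSampling hα_meas _ t
  have hqn : ∀ t h, ∀ᵐ y ∂(q t h), ‖y‖ ≤ β := fun t h => by
    filter_upwards [hq t h] with y hy using (ContinuousMap.norm_le y hβ0).2 (hβ y hy)
  have hqB : ∀ t h, ∀ᵐ y ∂(q t h), ∀ x x',
      (y x - y x') ^ 2 / 2 ≤ β * (β + C) / σ ^ 2 * (σ ^ 2 - k x x') := fun t h => by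
    filter_upwards [hq t h] with y hy
    exact hμ.sq_sub_le_of_kernelCondition hk_var hσ hk_cond hβ hy
  have hval : (OnlineLearning.gameValue μ 0 : OnlineLearning.History X T → ℝ) =
      OnlineLearning.realizedRegret := funext OnlineLearning.gameValue_zero
  refine ⟨OnlineLearning.integrable_supVal hn, ?_, ?_⟩
  · rw [← hval]
    exact OnlineLearning.integrable_gameValue hn hqn 0 T
  · rw [OnlineLearning.regret, ← hval]
    refine (OnlineLearning.integral_gameValue_le hμ hn hk_var hσ.ne' hα hα_meas hB hqn hqB hp
      (add_zero T)).trans_eq ?_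
    simp only [Nat.cast_zero, Real.sqrt_zero, OnlineLearning.supVal]
    ring
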